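/- Formulas of MLL over one propositional variable are built from the literals $p$, $p^\perp$ with $\otimes$ and $⅋$. A formula occurrence is a pair $\langle F,i\rangle$ of a formula and an index $i\in\mathbb N$. The links are: ID-links with two conclusions $\langle p,i\rangle,\langle p^\perp,j\rangle$ and no premise; $\otimes$-links with left premise $\langle A,i\rangle$, right premise $\langle B,j\rangle$ and conclusion $\langle A\otimes B,k\rangle$; and $⅋$-links, likewise with conclusion $\langle A⅋B,k\rangle$. A proof structure $\Theta=\langle\mathbb F,\mathbb L\rangle$ consists of a finite set $\mathbb F$ of occurrences and a finite set $\mathbb L$ of links, with premises and conclusions in $\mathbb F$, such that distinct occurrences in $\mathbb F$ have distinct indices, every occurrence is at most once a premise of a link (in particular, the two premises of a link are distinct occurrences), and every occurrence is a conclusion of exactly one link. A conclusion of $\Theta$ is an occurrence in $\mathbb F$ that is a premise of no link in $\mathbb L$. $\Theta$ is a proof net if it is sequentializable, where sequentializability of proof structures is defined inductively: $\Theta$ is sequentializable if (i) $\mathbb L$ consists of a single ID-link; or (ii) some $⅋$-link $L\in\mathbb L$ has as its conclusion $x$ a conclusion of $\Theta$, and $\langle\mathbb F\setminus\{x\},\mathbb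 L\setminus\{L\}\rangle$ is sequentializable; or (iii) some $\otimes$-link $L\in\mathbb L$ has as its conclusion $x$ a conclusion of $\Theta$, and there are disjoint unions $\mathbb F=\mathbb F_1\uplus\mathbb F_2\uplus\{x\}$, $\mathbb L=\mathbb L_1\uplus\mathbb L_2\uplus\{L\}$ such that $\langle\mathbb F_1,\mathbb L_1\rangle$ and $\langle\mathbb F_2,\mathbb L_2\rangle$ are sequentializable proof structures, the first containing the left premise of $L$ and the second the right premise. A switching $S$ selects one premise of every $⅋$-link of $\Theta$. The undirected graph $\Theta_S$ has the occurrences of $\Theta$ as nodes; its edges join the two conclusions of every ID-link, each of the two premises of every $\otimes$-link to its conclusion, and the selected premise of every $⅋$-link to its conclusion. For an occurrence $A$ of $\Theta$, let $\Theta_S^A$ be the connected component of $A$ in the graph obtained from $\Theta_S$ by deleting the edge, if there is one, from $A$ to the conclusion of the link of which $A$ is a premise. The empire of $A$ is $e_\Theta(A)=\bigcap_S \Theta_S^A$ (as sets of occurrences). An occurrence is a conclusion of $e_\Theta(A)$ if it belongs to $e_\Theta(A)$ and is not a premise of any link of $\Theta$ all of whose premises and conclusions belong to $e_\Theta(A)$.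 **Theorem.** Let $\Theta$ be a proof net, let $L_1$ be a $\otimes$-link of $\Theta$ with premises $A,B$ and conclusion $A\otimes B$, and let $L_2$ be a $⅋$-link of $\Theta$ with premises $C,D$ and conclusion $C⅋D$ ($A,B,C,D$ being formula occurrences). Let $\Theta'$ be the proof structure obtained from $\Theta$ by simultaneously replacing $L_1$ by the $⅋$-link with the same premises $A,B$ and conclusion $A⅋B$, and $L_2$ by the $\otimes$-link with the same premises $C,D$ and conclusion $C\otimes D$, all indices being kept and the formulas of all occurrences below these links being changed accordingly. Then $\Theta'$ is a proof net if and only if one of the following holds: 1. $C$ is a conclusion of $e_\Theta(A)$ and $D$ is a conclusion of $e_\Theta(B)$; 2. $D$ is a conclusion of $e_\Theta(A)$ and $C$ is a conclusion of $e_\Theta(B)$. -/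

import Mathlib

namespace MLL

/-- The two binary connectives. -/
inductive Conn : Type
  | tens
  | par
  deriving DecidableEq

/-- The dual connective. -/
def Conn.flip : Conn → Conn
  | .tens => .par
  | .par => .tens

/-- Formulas over one propositional variable: the literals `p` (`pos`) and `p^⊥` (`neg`), and
`F ⊗ G` (`bin Conn.tens F G`) and `F ⅋ G` (`bin Conn.par F G`). -/
inductive Formula : Type
  | pos
  | neg
  | bin (c : Conn) (F G : Formula)
  deriving DecidableEq

/-- Formula occurrences: a formula together with a natural number, its index. -/
abbrev Occ : Type := Formula × ℕ

/-- Links. `ax i j` is the ID-link with the two conclusions `⟨p, i⟩` and `⟨p^⊥, j⟩` and no premise.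
`bin c A i B j k` has left premise `⟨A, i⟩`, right premise `⟨B, j⟩` and conclusion `⟨A c B, k⟩`;
it is a `⊗`-link or a `⅋`-link according to `c`. -/
inductive Link : Type
  | ax (i j : ℕ)
  | bin (c : Conn) (A : Formula) (i : ℕ) (B : Formula) (j : ℕ) (k : ℕ)
  deriving DecidableEq

namespace Link

/-- The premises of a link. -/
def premises : Link → Finset Occ
  | .ax _ _ => ∅
  | .bin _ A i B j _ => {(A, i), (B, j)}

/-- The conclusions of a link. -/
def conclusions : Link → Finset Occ
  | .ax i j => {(.pos, i), (.neg, j)}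
  | .bin c A _ B _ k => {(.bin c A B, k)}

end Link

/-- A finite set of formula occurrences together with a finite set of links. -/
structure Structure : Type where
  /-- the formula occurrences -/
  forms : Finset Occ
  /-- the links -/
  links : Finset Link

namespace Structure

/-- MLL proof structures. -/
structure IsProofStructure (Θ : Structure) : Prop where
  /-- the premises of a link belong to the structure -/
  premises_subset : ∀ L ∈ Θ.links, L.premises ⊆ Θ.forms
  /-- the conclusions of a link belong to the structure -/
  conclusions_subset : ∀ L ∈ Θ.links, L.conclusions ⊆ Θ.forms
  /-- different occurrences have different indices -/
  index_inj : ∀ x ∈ Θ.forms, ∀ y ∈ Θ.forms, x.2 = y.2 → x = y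
  /-- an occurrence is a premise of at most one link ... -/
  premise_unique : ∀ x ∈ Θ.forms, ∀ L ∈ Θ.links, ∀ L' ∈ Θ.links,
    x ∈ L.premises → x ∈ L'.premises → L = L'
  /-- ... and not both its left and its right premise -/
  premises_ne : ∀ c A i B j k, Link.bin c A i B j k ∈ Θ.links → (A, i) ≠ (B, j)
  /-- an occurrence is a conclusion of exactly one link -/
  conclusion_unique : ∀ x ∈ Θ.forms, ∃! L, L ∈ Θ.links ∧ x ∈ L.conclusions

/-- The occurrence `x` is a conclusion of `Θ`: it belongs to `Θ` and is a premise of no link. -/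
def IsConclusion (Θ : Structure) (x : Occ) : Prop :=
  x ∈ Θ.forms ∧ ∀ L ∈ Θ.links, x ∉ L.premises

/-- Sequentializable proof structures. -/
inductive Sequentializable : Structure → Prop
  /-- a single ID-link -/
  | ax (Θ : Structure) (i j : ℕ) (hΘ : Θ.IsProofStructure)
      (hL : Θ.links = {Link.ax i j}) : Sequentializable Θ
  /-- removing a final `⅋`-link -/
  | par (Θ : Structure) (A B : Formula) (i j k : ℕ) (hΘ : Θ.IsProofStructure)
      (hL : Link.bin .par A i B j k ∈ Θ.links)
      (hconc : Θ.IsConclusion (.bin .par A B, k))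
      (hseq : Sequentializable
        ⟨Θ.forms.erase (.bin .par A B, k), Θ.links.erase (.bin .par A i B j k)⟩) :
      Sequentializable Θ
  /-- removing a final `⊗`-link and splitting the rest into two disjoint proof structures, the
  first containing the left premise and the second the right premise -/
  | tens (Θ Θ₁ Θ₂ : Structure) (A B : Formula) (i j k : ℕ) (hΘ : Θ.IsProofStructure)
      (hL : Link.bin .tens A i B j k ∈ Θ.links)
      (hconc : Θ.IsConclusion (.bin .tens A B, k))
      (hforms : Θ.forms = insert (.bin .tens A B, k) (Θ₁.forms ∪ Θ₂.forms))
      (hforms_disj : Disjoint Θ₁.forms Θ₂.forms)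
      (hforms_notMem : (Formula.bin .tens A B, k) ∉ Θ₁.forms ∪ Θ₂.forms)
      (hlinks : Θ.links = insert (.bin .tens A i B j k) (Θ₁.links ∪ Θ₂.links))
      (hlinks_disj : Disjoint Θ₁.links Θ₂.links)
      (hlinks_notMem : Link.bin .tens A i B j k ∉ Θ₁.links ∪ Θ₂.links)
      (hA : (A, i) ∈ Θ₁.forms) (hB : (B, j) ∈ Θ₂.forms)
      (hΘ₁ : Θ₁.IsProofStructure) (hΘ₂ : Θ₂.IsProofStructure)
      (hseq₁ : Sequentializable Θ₁) (hseq₂ : Sequentializable Θ₂) :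
      Sequentializable Θ

/-- MLL proof nets. -/
def IsProofNet (Θ : Structure) : Prop :=
  Θ.IsProofStructure ∧ Θ.Sequentializable

/-- A Danos-Regnier switching selects the left (`false`) or the right (`true`) premise of every
`⅋`-link; its values at other links play no role. -/
abbrev Switching : Type := Link → Bool

/-- The edges of the Danos-Regnier graph of `Θ` for the switching `S`, each listed in one
direction. -/
inductive DREdge (Θ : Structure) (S : Switching) : Occ → Occ → Prop
  | ax (i j : ℕ) (hL : Link.ax i j ∈ Θ.links) : DREdge Θ S (.pos, i) (.neg, j)
  | tens_left (A B : Formula) (i j k : ℕ) (hL : Link.bin .tens A i B j k ∈ Θ.links) :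
      DREdge Θ S (A, i) (.bin .tens A B, k)
  | tens_right (A B : Formula) (i j k : ℕ) (hL : Link.bin .tens A i B j k ∈ Θ.links) :
      DREdge Θ S (B, j) (.bin .tens A B, k)
  | par_left (A B : Formula) (i j k : ℕ) (hL : Link.bin .par A i B j k ∈ Θ.links)
      (hS : S (.bin .par A i B j k) = false) : DREdge Θ S (A, i) (.bin .par A B, k)
  | par_right (A B : Formula) (i j k : ℕ) (hL : Link.bin .par A i B j k ∈ Θ.links)
      (hS : S (.bin .par A i B j k) = true) : DREdge Θ S (B, j) (.bin .par A B, k)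

/-- The Danos-Regnier graph. Its nodes are the occurrences in `Θ`; all other elements of `Occ` are
isolated points. -/
def drGraph (Θ : Structure) (S : Switching) : SimpleGraph Occ :=
  SimpleGraph.fromRel (DREdge Θ S)

/-- The Danos-Regnier graph without the edge, if it is there, from `a` to the conclusion of the link
of which `a` is a premise. -/
def cutGraph (Θ : Structure) (S : Switching) (a : Occ) : SimpleGraph Occ :=
  (Θ.drGraph S).deleteEdges
    {e | ∃ L ∈ Θ.links, a ∈ L.premises ∧ ∃ c ∈ L.conclusions, e = s(a, c)}

open Classical in
/-- The empire of `a` in `Θ`: the occurrences that, for every switching `S`, lie in the connected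
component of `a` in `Θ.cutGraph S a`. -/
noncomputable def empireForms (Θ : Structure) (a : Occ) : Finset Occ :=
  {x ∈ Θ.forms | ∀ S : Switching, (Θ.cutGraph S a).Reachable a x}

/-- The empire of `a` in `Θ`, together with the links of `Θ` all of whose premises and conclusions
belong to it. -/
noncomputable def empire (Θ : Structure) (a : Occ) : Structure where
  forms := Θ.empireForms a
  links := {L ∈ Θ.links | L.premises ⊆ Θ.empireForms a ∧ L.conclusions ⊆ Θ.empireForms a}

open Classical in
/-- The formula that the occurrence `⟨F, k⟩` of `Θ` carries after the connective of every link in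
`X` has been replaced by its dual: it is rebuilt from the premises of the link of `Θ` that has
`⟨F, k⟩` as its conclusion. In a proof structure this link is unique, and it exists. -/
noncomputable def flipFormula (Θ : Structure) (X : Finset Link) : Formula → ℕ → Formula
  | .pos, _ => .pos
  | .neg, _ => .neg
  | .bin c A B, k =>
      if h : ∃ q : ℕ × ℕ, Link.bin c A q.1 B q.2 k ∈ Θ.links then
        .bin (if Link.bin c A h.choose.1 B h.choose.2 k ∈ X then c.flip else c)
          (flipFormula Θ X A h.choose.1) (flipFormula Θ X B h.choose.2)
      else .bin c A B

/-- An occurrence after replacing the connective of every link in `X` by its dual. -/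
noncomputable def flipOcc (Θ : Structure) (X : Finset Link) (x : Occ) : Occ :=
  (Θ.flipFormula X x.1 x.2, x.2)

/-- A link after replacing the connective of every link in `X` by its dual. -/
noncomputable def flipLink (Θ : Structure) (X : Finset Link) : Link → Link
  | .ax i j => .ax i j
  | .bin c A i B j k =>
      .bin (if Link.bin c A i B j k ∈ X then c.flip else c)
        (Θ.flipFormula X A i) i (Θ.flipFormula X B j) j k

/-- The `⊗`-`⅋`-exchange of `Θ` by a `⊗`-link `L₁` and a `⅋`-link `L₂`: the two links exchange their
connectives, all indices and incidences stay the same, and the formulas further below are updated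
accordingly. -/
noncomputable def exchange (Θ : Structure) (L₁ L₂ : Link) : Structure where
  forms := Θ.forms.image (Θ.flipOcc {L₁, L₂})
  links := Θ.links.image (Θ.flipLink {L₁, L₂})

end Structure

end MLL

/-! The statement concerns incidences, so occurrences are replaced by their indices and a proof
structure by an abstract `Net`. There the Danos-Regnier criterion is available: a nonempty proof
structure is sequentializable if and only if all its switching graphs are trees. One direction holds
because adding a ⅋-link adds a leaf to each graph and a ⊗-link joins two disjoint trees
(`Sequentializable.net_correct`). The other goes by induction on the number of links: a final ⅋-link
can be removed, and if there is none, a final ⊗-link whose two empires are largest together must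
split the net (`exists_splitting`).

Now let the net be correct, and let a, b be the premises of the ⊗-link with conclusion t, and c, d
those of the ⅋-link with conclusion q. For a fixed switching, the exchange deletes one edge above t
and inserts the missing edge above q (`flip_graph`). A tree with one edge exchanged is again a tree
exactly when the new edge reconnects the two halves, that is, when c and d are separated by the
deletion. Both edges above t can be the deleted one, so correctness of the new net means that, for
every switching, one of c, d lies in the component of a and the other in that of b
(`flip_correct_iff_forall`).

It remains to see that the assignment of c, d to a, b does not depend on the switching. When a
switching changes at one ⅋-link, the premise selected before lies in at most one of the two disjoint
components, so the other component can only grow (`cut_reachable_update`). Hence a single change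
cannot swap the roles of c and d, and finitely many changes lead to any other switching.
Reachability for all switchings is membership in the empire. Finally, the two empires are disjoint,
so neither can contain both c and d, and a premise of the ⅋-link that lies in one of them is
automatically a conclusion of it. -/

/-! ### Trees on a set of vertices -/

namespace SimpleGraph

variable {V : Type*} {G H : SimpleGraph V}

/-- A property that is preserved along the edges of `G` holds at all vertices that are reachable
from a vertex where it holds. -/
theorem Reachable.closure {P : V → Prop} {x y : V} (h : G.Reachable x y) (hx : P x)
    (hP : ∀ u v, G.Reachable x u → P u → G.Adj u v → P v) : P y := by
  rw [reachable_eq_reflTransGen] at h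
  induction h with
  | refl => exact hx
  | tail hu huv ih =>
    exact hP _ _ (by rw [reachable_eq_reflTransGen]; exact hu) ih huv

/-- If every edge of `G` at a vertex reachable from `x` belongs to `H`, then reachability from `x`
in `G` implies reachability in `H`. -/
theorem Reachable.of_adj {x y : V} (h : G.Reachable x y)
    (hH : ∀ u v, G.Reachable x u → G.Adj u v → H.Adj u v) : H.Reachable x y :=
  h.closure (P := fun y => H.Reachable x y) .rfl
    fun u v hu hxu huv => hxu.trans (hH u v hu huv).reachable

/-- A vertex reachable in `G` is reachable without a given edge from the starting point or from the
two endpoints of the edge. -/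
theorem Reachable.sup_edge {x y u v : V} (h : (G ⊔ edge u v).Reachable x y) :
    G.Reachable x y ∨ G.Reachable u y ∨ G.Reachable v y := by
  refine h.closure (P := fun y => G.Reachable x y ∨ G.Reachable u y ∨ G.Reachable v y)
    (.inl .rfl) fun a b _ ha hab => ?_
  rw [sup_adj, edge_adj] at hab
  rcases hab with hab | ⟨⟨rfl, rfl⟩ | ⟨rfl, rfl⟩, -⟩
  · rcases ha with ha | ha | ha
    · exact .inl (ha.trans hab.reachable)
    · exact .inr (.inl (ha.trans hab.reachable))
    · exact .inr (.inr (ha.trans hab.reachable))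
  · exact .inr (.inr .rfl)
  · exact .inr (.inl .rfl)

/-- The graph `G` is a tree with vertex set `W`, all other vertices being isolated. -/
structure IsTreeOn (G : SimpleGraph V) (W : Set V) : Prop where
  mem : ∀ {u v}, G.Adj u v → u ∈ W
  reachable : ∀ {u v}, u ∈ W → v ∈ W → G.Reachable u v
  acyclic : G.IsAcyclic

theorem isTreeOn_singleton (x : V) : (⊥ : SimpleGraph V).IsTreeOn {x} where
  mem h := h.elim
  reachable := by rintro u v rfl rfl; exact .rfl
  acyclic := isAcyclic_bot

theorem Reachable.mem_of_closed {W : Set V} {x y : V} (hW : ∀ u v, G.Adj u v → u ∈ W)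
    (h : G.Reachable x y) (hx : x ∈ W) : y ∈ W :=
  h.closure (P := fun y => y ∈ W) hx fun _ _ _ _ huv => hW _ _ huv.symm

/-- Two disjoint trees joined by an edge form a tree. -/
theorem IsTreeOn.join {W W' : Set V} (hG : G.IsTreeOn W) (hH : H.IsTreeOn W')
    (hd : Disjoint W W') {x y : V} (hx : x ∈ W) (hy : y ∈ W') :
    (G ⊔ H ⊔ edge x y).IsTreeOn (W ∪ W') := by
  have hxy : x ≠ y := fun h => Set.disjoint_left.1 hd hx (h ▸ hy)
  have left : ∀ {a b}, a ∈ W → (G ⊔ H).Adj a b → G.Adj a b := by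
    rintro a b ha (h | h)
    · exact h
    · exact (Set.disjoint_left.1 hd ha (hH.mem h)).elim
  have right : ∀ {a b}, a ∈ W' → (G ⊔ H).Adj a b → H.Adj a b := by
    rintro a b ha (h | h)
    · exact (Set.disjoint_left.1 hd (hG.mem h) ha).elim
    · exact h
  have leftMem : ∀ {a b}, (G ⊔ H).Reachable a b → a ∈ W → b ∈ W := fun h ha =>
    h.closure (P := fun y => y ∈ W) ha fun u v _ hu huv => hG.mem (left hu huv).symm
  have rightMem : ∀ {a b}, (G ⊔ H).Reachable a b → a ∈ W' → b ∈ W' := fun h ha =>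
    h.closure (P := fun y => y ∈ W') ha fun u v _ hu huv => hH.mem (right hu huv).symm
  refine ⟨?_, ?_, ?_⟩
  · intro u v h
    rw [sup_adj, sup_adj, edge_adj] at h
    rcases h with (h | h) | ⟨⟨rfl, rfl⟩ | ⟨rfl, rfl⟩, -⟩
    · exact .inl (hG.mem h)
    · exact .inr (hH.mem h)
    · exact .inl hx
    · exact .inr hy
  · have key : ∀ u ∈ W ∪ W', (G ⊔ H ⊔ edge x y).Reachable x u := by
      rintro u (hu | hu)
      · exact (hG.reachable hx hu).mono (le_sup_of_le_left le_sup_left)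
      · refine Reachable.trans (v := y) (Adj.reachable ?_)
          ((hH.reachable hy hu).mono (le_sup_of_le_left le_sup_right))
        rw [sup_adj, edge_adj]
        exact .inr ⟨.inl ⟨rfl, rfl⟩, hxy⟩
    intro u v hu hv
    exact (key u hu).symm.trans (key v hv)
  · refine IsAcyclic.sup_edge_of_not_reachable
      (fun h => Set.disjoint_left.1 hd (leftMem h hx) hy) ?_
    -- Acyclicity of the disjoint union is checked through bridges: a walk starting at an end of an
    -- edge stays in the part of that edge, so a detour around the edge would already exist in `G`
    -- or in `H`.
    rw [isAcyclic_iff_forall_adj_isBridge]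
    intro u v huv
    rw [isBridge_iff]
    intro h
    rcases huv with huv | huv
    · refine isBridge_iff.1 (isAcyclic_iff_forall_adj_isBridge.1 hG.acyclic huv) (h.of_adj ?_)
      intro a b ha hab
      rw [deleteEdges_adj] at hab ⊢
      exact ⟨left (leftMem (ha.mono (deleteEdges_le _)) (hG.mem huv)) hab.1, hab.2⟩
    · refine isBridge_iff.1 (isAcyclic_iff_forall_adj_isBridge.1 hH.acyclic huv) (h.of_adj ?_)
      intro a b ha hab
      rw [deleteEdges_adj] at hab ⊢
      exact ⟨right (rightMem (ha.mono (deleteEdges_le _)) (hH.mem huv)) hab.1, hab.2⟩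

/-- Adding a leaf to a tree. -/
theorem IsTreeOn.add_leaf {W : Set V} (hG : G.IsTreeOn W) {x y : V} (hx : x ∈ W) (hy : y ∉ W) :
    (G ⊔ edge x y).IsTreeOn (insert y W) := by
  have := hG.join (isTreeOn_singleton y) (Set.disjoint_singleton_right.2 hy) hx rfl
  rwa [sup_bot_eq, Set.union_singleton] at this

/-- Removing an edge from a tree disconnects its endpoints. -/
theorem IsTreeOn.not_reachable {W : Set V} {x y : V} (h : (G ⊔ edge x y).IsTreeOn W)
    (hxy : x ≠ y) (hadj : ¬ G.Adj x y) : ¬ G.Reachable x y := fun hr =>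
  ((isAcyclic_sup_fromEdgeSet_iff.1 h.acyclic).2 hr).elim hxy hadj

/-- Replacing an edge of a tree by another one yields a tree if and only if the new edge joins the
two components that remain after the removal of the old one. -/
theorem IsTreeOn.exchange {W : Set V} {x y u v : V} (h : (G ⊔ edge x y).IsTreeOn W)
    (hxy : x ≠ y) (hu : u ∈ W) (hv : v ∈ W) (huv : u ≠ v)
    (hadj' : ¬ G.Adj u v) : (G ⊔ edge u v).IsTreeOn W ↔ ¬ G.Reachable u v := by
  refine ⟨fun h' => h'.not_reachable huv hadj', fun hr => ?_⟩
  have hxW : x ∈ W := h.mem (v := y) (by rw [sup_adj, edge_adj]; exact .inr ⟨.inl ⟨rfl, rfl⟩, hxy⟩)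
  have cover : ∀ z ∈ W, G.Reachable x z ∨ G.Reachable y z := fun z hz => by
    rcases (h.reachable hxW hz).sup_edge with h | h | h
    · exact .inl h
    · exact .inl h
    · exact .inr h
  -- `G` has at most two components on `W`, those of `x` and `y`. Since `u` and `v` are not
  -- connected, each lies in a different one, and the two together represent all of `W`.
  have cover' : ∀ z ∈ W, G.Reachable u z ∨ G.Reachable v z := fun z hz => by
    rcases cover z hz with h1 | h1 <;> rcases cover u hu with h2 | h2 <;>
      rcases cover v hv with h3 | h3
    · exact (hr (h2.symm.trans h3)).elim
    · exact .inl (h2.symm.trans h1)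
    · exact .inr (h3.symm.trans h1)
    · exact (hr (h2.symm.trans h3)).elim
    · exact (hr (h2.symm.trans h3)).elim
    · exact .inr (h3.symm.trans h1)
    · exact .inl (h2.symm.trans h1)
    · exact (hr (h2.symm.trans h3)).elim
  have key : ∀ z ∈ W, (G ⊔ edge u v).Reachable u z := fun z hz => by
    rcases cover' z hz with h | h
    · exact h.mono le_sup_left
    · refine Reachable.trans (v := v) (Adj.reachable ?_) (h.mono le_sup_left)
      rw [sup_adj, edge_adj]
      exact .inr ⟨.inl ⟨rfl, rfl⟩, huv⟩
  refine ⟨?_, fun ha hb => (key _ ha).symm.trans (key _ hb),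
    IsAcyclic.sup_edge_of_not_reachable hr (h.acyclic.anti le_sup_left)⟩
  intro a b hab
  rw [sup_adj, edge_adj] at hab
  rcases hab with hab | ⟨⟨rfl, rfl⟩ | ⟨rfl, rfl⟩, -⟩
  · exact h.mem (.inl hab)
  · exact hu
  · exact hv

end SimpleGraph

/-! ### Abstract nets -/

namespace MLL

/-- The incidence structure of a proof structure, its occurrences being represented by their
indices. -/
structure Net : Type where
  verts : Finset ℕ
  ax : ℕ → ℕ → Prop
  bin : Conn → ℕ → ℕ → ℕ → Prop

namespace Net

/-- The vertex `u` is a premise of a link with conclusion `v`. -/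
def Below (N : Net) (u v : ℕ) : Prop := ∃ c w, N.bin c u w v ∨ N.bin c w u v

/-- The vertex `u` is a premise of a link with conclusion `v`, and it is selected if this is a
`⅋`-link. -/
def Up (N : Net) (S : ℕ → Bool) (u v : ℕ) : Prop :=
  ∃ c w, (N.bin c u w v ∧ (c = .par → S v = false)) ∨ (N.bin c w u v ∧ (c = .par → S v = true))

/-- The Danos-Regnier graph. -/
def graph (N : Net) (S : ℕ → Bool) : SimpleGraph ℕ :=
  SimpleGraph.fromRel fun u v => N.ax u v ∨ N.Up S u v

/-- The Danos-Regnier graph without the edge below `a`. -/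
def cut (N : Net) (S : ℕ → Bool) (a : ℕ) : SimpleGraph ℕ :=
  (N.graph S).deleteEdges {e | ∃ v, N.Below a v ∧ e = s(a, v)}

/-- The empire of `a`. -/
def empire (N : Net) (a : ℕ) : Set ℕ := {x | ∀ S, (N.cut S a).Reachable a x}

/-- The Danos-Regnier criterion. -/
def Correct (N : Net) : Prop := ∀ S, (N.graph S).IsTreeOn N.verts

/-- The incidence conditions on proof structures. -/
structure WF (N : Net) : Prop where
  ax_mem : ∀ {i j}, N.ax i j → i ∈ N.verts ∧ j ∈ N.verts
  bin_mem : ∀ {c i j k}, N.bin c i j k → i ∈ N.verts ∧ j ∈ N.verts ∧ k ∈ N.verts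
  ax_ne : ∀ {i j}, N.ax i j → i ≠ j
  premise_ne : ∀ {c i j k}, N.bin c i j k → i ≠ j
  rank : ∃ r : ℕ → ℕ, ∀ {u v}, N.Below u v → r u < r v
  below_unique : ∀ {u v v'}, N.Below u v → N.Below u v' → v = v'
  bin_unique : ∀ {c i j k c' i' j'}, N.bin c i j k → N.bin c' i' j' k → c = c' ∧ i = i' ∧ j = j'
  ax_not_bin : ∀ {i j}, N.ax i j → ∀ c x y, ¬ N.bin c x y i ∧ ¬ N.bin c x y j
  cover : ∀ {x}, x ∈ N.verts → (∃ y, N.ax x y ∨ N.ax y x) ∨ ∃ c i j, N.bin c i j x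

variable {N : Net} {S : ℕ → Bool} {a b u v : ℕ}

theorem Up.below (h : N.Up S u v) : N.Below u v := by
  obtain ⟨c, w, h | h⟩ := h
  · exact ⟨c, w, .inl h.1⟩
  · exact ⟨c, w, .inr h.1⟩

theorem Below.up (h : N.Below u v) : ∃ S, N.Up S u v := by
  obtain ⟨c, w, h | h⟩ := h
  · exact ⟨fun _ => false, c, w, .inl ⟨h, fun _ => rfl⟩⟩
  · exact ⟨fun _ => true, c, w, .inr ⟨h, fun _ => rfl⟩⟩

theorem cut_le : N.cut S a ≤ N.graph S := SimpleGraph.deleteEdges_le _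

theorem mem_empire_self (N : Net) (a : ℕ) : a ∈ N.empire a := fun _ => .rfl

namespace WF

theorem below_ne (hN : N.WF) (h : N.Below u v) : u ≠ v := by
  obtain ⟨r, hr⟩ := hN.rank
  rintro rfl
  exact (hr h).false

theorem below_asymm (hN : N.WF) (h : N.Below u v) : ¬ N.Below v u := by
  obtain ⟨r, hr⟩ := hN.rank
  exact fun h' => ((hr h).trans (hr h')).false

theorem ax_not_below (hN : N.WF) (h : N.ax u v) (x : ℕ) : ¬ N.Below x u ∧ ¬ N.Below x v := by
  constructor <;> rintro ⟨c, w, h' | h'⟩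
  · exact (hN.ax_not_bin h _ _ _).1 h'
  · exact (hN.ax_not_bin h _ _ _).1 h'
  · exact (hN.ax_not_bin h _ _ _).2 h'
  · exact (hN.ax_not_bin h _ _ _).2 h'

theorem below_mem (hN : N.WF) (h : N.Below u v) : u ∈ N.verts ∧ v ∈ N.verts := by
  obtain ⟨c, w, h | h⟩ := h
  · exact ⟨(hN.bin_mem h).1, (hN.bin_mem h).2.2⟩
  · exact ⟨(hN.bin_mem h).2.1, (hN.bin_mem h).2.2⟩

theorem graph_adj (hN : N.WF) :
    (N.graph S).Adj u v ↔ N.ax u v ∨ N.ax v u ∨ N.Up S u v ∨ N.Up S v u := by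
  rw [graph, SimpleGraph.fromRel_adj]
  constructor
  · tauto
  · rintro (h | h | h | h)
    · exact ⟨hN.ax_ne h, .inl (.inl h)⟩
    · exact ⟨(hN.ax_ne h).symm, .inr (.inl h)⟩
    · exact ⟨hN.below_ne h.below, .inl (.inr h)⟩
    · exact ⟨(hN.below_ne h.below).symm, .inr (.inr h)⟩

/-- A deleted edge is recognized by its upper end alone. An ID-edge is never deleted, because its
ends are conclusions of no binary link, and the rank forbids that an edge below `a` is at the same
time an edge from a premise to `a`. -/
theorem cut_adj (hN : N.WF) : (N.cut S a).Adj u v ↔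
    N.ax u v ∨ N.ax v u ∨ (N.Up S u v ∧ u ≠ a) ∨ (N.Up S v u ∧ v ≠ a) := by
  rw [cut, SimpleGraph.deleteEdges_adj, hN.graph_adj]
  simp only [Set.mem_ofPred_eq, Sym2.eq_iff, not_exists, not_and, not_or]
  constructor
  · rintro ⟨h | h | h | h, hc⟩
    · exact .inl h
    · exact .inr (.inl h)
    · refine .inr (.inr (.inl ⟨h, ?_⟩))
      rintro rfl
      exact (hc v h.below).1 rfl rfl
    · refine .inr (.inr (.inr ⟨h, ?_⟩))
      rintro rfl
      exact (hc u h.below).2 rfl rfl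
  · rintro (h | h | ⟨h, ha⟩ | ⟨h, ha⟩)
    · refine ⟨.inl h, fun x hx => ⟨?_, ?_⟩⟩
      · rintro rfl rfl
        exact (hN.ax_not_below h _).2 hx
      · rintro rfl rfl
        exact (hN.ax_not_below h _).1 hx
    · refine ⟨.inr (.inl h), fun x hx => ⟨?_, ?_⟩⟩
      · rintro rfl rfl
        exact (hN.ax_not_below h _).1 hx
      · rintro rfl rfl
        exact (hN.ax_not_below h _).2 hx
    · refine ⟨.inr (.inr (.inl h)), fun x hx => ⟨fun hu => (ha hu).elim, ?_⟩⟩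
      rintro rfl rfl
      exact hN.below_asymm hx h.below
    · refine ⟨.inr (.inr (.inr h)), fun x hx => ⟨?_, fun _ hv => (ha hv).elim⟩⟩
      rintro rfl rfl
      exact hN.below_asymm hx h.below

theorem graph_adj_mem (hN : N.WF) (h : (N.graph S).Adj u v) : u ∈ N.verts := by
  rcases hN.graph_adj.1 h with h | h | h | h
  · exact (hN.ax_mem h).1
  · exact (hN.ax_mem h).2
  · exact (hN.below_mem h.below).1
  · exact (hN.below_mem h.below).2

theorem empire_subset (hN : N.WF) (ha : a ∈ N.verts) : N.empire a ⊆ N.verts := fun _ hx =>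
  (hx fun _ => false).mem_of_closed (fun _ _ h => hN.graph_adj_mem (cut_le h)) ha

theorem up_total (hN : N.WF) (h : N.Up S u v) {c : Conn} {i j : ℕ} (hb : N.bin c i j v) :
    u = i ∧ (c = .par → S v = false) ∨ u = j ∧ (c = .par → S v = true) := by
  obtain ⟨c', w, ⟨h, hS⟩ | ⟨h, hS⟩⟩ := h
  · obtain ⟨rfl, rfl, rfl⟩ := hN.bin_unique h hb
    exact .inl ⟨rfl, hS⟩
  · obtain ⟨rfl, rfl, rfl⟩ := hN.bin_unique h hb
    exact .inr ⟨rfl, hS⟩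

/-- The edge between a premise and a conclusion is a bridge. -/
theorem cut_not_reachable (hN : N.WF) (hc : N.Correct) (h : N.Up S a v) :
    ¬ (N.cut S a).Reachable a v := by
  have h1 := SimpleGraph.isBridge_iff.1 (SimpleGraph.isAcyclic_iff_forall_adj_isBridge.1
    (hc S).acyclic (hN.graph_adj.2 (.inr (.inr (.inl h)))))
  refine fun h2 => h1 (h2.mono ?_)
  intro p q hpq
  rw [cut, SimpleGraph.deleteEdges_adj] at hpq
  rw [SimpleGraph.deleteEdges_adj]
  exact ⟨hpq.1, fun he => hpq.2 ⟨v, h.below, he⟩⟩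

/-- Without the edge from `a` to `v`, every vertex is connected to `a` or to `v`. -/
theorem cut_reachable_or (hN : N.WF) (hc : N.Correct) (h : N.Up S a v) {x : ℕ}
    (hx : x ∈ N.verts) : (N.cut S a).Reachable a x ∨ (N.cut S a).Reachable v x := by
  have hle : N.graph S ≤ N.cut S a ⊔ SimpleGraph.edge a v := by
    intro p q hpq
    by_cases hcut : (N.cut S a).Adj p q
    · exact .inl hcut
    · refine .inr ?_
      rw [SimpleGraph.edge_adj]
      refine ⟨?_, hpq.ne⟩
      rw [hN.cut_adj] at hcut
      rcases hN.graph_adj.1 hpq with h' | h' | h' | h'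
      · tauto
      · tauto
      · have : p = a := by tauto
        subst this
        exact .inl ⟨rfl, hN.below_unique h'.below h.below⟩
      · have : q = a := by tauto
        subst this
        exact .inr ⟨hN.below_unique h'.below h.below, rfl⟩
  rcases (((hc S).reachable (hN.below_mem h.below).1 hx).mono hle).sup_edge with h | h | h
  · exact .inl h
  · exact .inl h
  · exact .inr h

theorem ax_mem_empire (hN : N.WF) (h : N.ax u v) : u ∈ N.empire a ↔ v ∈ N.empire a :=
  ⟨fun hu S => (hu S).trans (hN.cut_adj.2 (.inl h)).reachable,
    fun hu S => (hu S).trans (hN.cut_adj.2 (.inr (.inl h))).reachable⟩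

/-- Some switching selects the premise `a`, and for it the edge to `v` is a bridge. -/
theorem not_mem_empire_of_below (hN : N.WF) (hc : N.Correct) (h : N.Below a v) :
    v ∉ N.empire a := fun hv => by
  obtain ⟨S, hS⟩ := h.up
  exact hN.cut_not_reachable hc hS (hv S)

/-- The premises of a link whose conclusion belongs to an empire belong to the empire. -/
theorem mem_empire_of_below (hN : N.WF) (hc : N.Correct) (h : N.Below u v)
    (hv : v ∈ N.empire a) : u ∈ N.empire a := by
  intro S
  by_cases hua : u = a
  · subst hua; exact .rfl
  by_cases hS : N.Up S u v
  · exact (hv S).trans (hN.cut_adj.2 (.inr (.inr (.inr ⟨hS, hua⟩)))).reachable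
  -- another premise `w` is selected by `S`, whereas `S'` selects `u`
  obtain ⟨S', hS', hoff⟩ : ∃ S', N.Up S' u v ∧ ∀ x, x ≠ v → S' x = S x := by
    obtain ⟨c, w, h | h⟩ := h
    · exact ⟨Function.update S v false, ⟨c, w, .inl ⟨h, by simp⟩⟩, by simp +contextual⟩
    · exact ⟨Function.update S v true, ⟨c, w, .inr ⟨h, by simp⟩⟩, by simp +contextual⟩
  obtain ⟨w, hw⟩ : ∃ w, N.Up S w v := by
    obtain ⟨c, w, h | h⟩ := h
    · refine ⟨w, c, u, .inr ⟨h, fun hp => ?_⟩⟩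
      by_contra hf
      exact hS ⟨c, w, .inl ⟨h, fun _ => by simpa using hf⟩⟩
    · refine ⟨w, c, u, .inl ⟨h, fun hp => ?_⟩⟩
      by_contra hf
      exact hS ⟨c, w, .inr ⟨h, fun _ => by simpa using hf⟩⟩
  have hupne : ∀ {p q}, q ≠ v → (N.Up S' p q ↔ N.Up S p q) := fun {p q} hq => by
    simp only [Up, hoff q hq]
  have hS'uniq : ∀ {p}, N.Up S' p v → p = u := fun {p} hp => by
    by_contra hpu
    apply hS
    obtain ⟨c, x, ⟨h1, h2⟩ | ⟨h1, h2⟩⟩ := hp <;> obtain ⟨c', y, ⟨h3, h4⟩ | ⟨h3, h4⟩⟩ := hS' <;>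
      obtain ⟨rfl, rfl, rfl⟩ := hN.bin_unique h1 h3
    · exact (hpu rfl).elim
    · exact ⟨c, p, .inr ⟨h1, fun hp => by simp_all⟩⟩
    · exact ⟨c, p, .inl ⟨h1, fun hp => by simp_all⟩⟩
    · exact (hpu rfl).elim
  have hSuniq : ∀ {p}, N.Up S p v → p = w := fun {p} hp => by
    obtain ⟨c, x, ⟨h1, h2⟩ | ⟨h1, h2⟩⟩ := hp <;> obtain ⟨c', y, ⟨h3, h4⟩ | ⟨h3, h4⟩⟩ := hw <;>
      obtain ⟨rfl, rfl, rfl⟩ := hN.bin_unique h1 h3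
    · rfl
    · by_contra
      refine hS ?_
      obtain ⟨c', y, h | h⟩ := h <;> obtain ⟨rfl, rfl, rfl⟩ := hN.bin_unique h1 h
      · exact ⟨_, _, .inl ⟨h1, h2⟩⟩
      · exact ⟨_, _, .inr ⟨h1, h4⟩⟩
    · by_contra
      refine hS ?_
      obtain ⟨c', y, h | h⟩ := h <;> obtain ⟨rfl, rfl, rfl⟩ := hN.bin_unique h1 h
      · exact ⟨_, _, .inl ⟨h1, h4⟩⟩
      · exact ⟨_, _, .inr ⟨h1, h2⟩⟩
    · rfl
  -- the graph without the edges above `v` that distinguish `S` and `S'`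
  have hkey : ∀ {p q}, N.Up S' p q ∧ p ≠ u ↔ N.Up S p q ∧ p ≠ w := fun {p q} => by
    by_cases hq : q = v
    · subst hq
      exact ⟨fun h => (h.2 (hS'uniq h.1)).elim, fun h => (h.2 (hSuniq h.1)).elim⟩
    · rw [hupne hq]
      refine and_congr_right fun h' => ⟨?_, ?_⟩
      · rintro - rfl
        exact hq (hN.below_unique h'.below hw.below)
      · rintro - rfl
        exact hq (hN.below_unique h'.below h)
  have hcut : ∀ {p q}, (N.cut S' u).Adj p q ↔ (N.cut S w).Adj p q := fun {p q} => by
    rw [hN.cut_adj, hN.cut_adj, hkey, hkey]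
  -- The forest common to both switchings has the component of `v` and one other. The bridge
  -- property under `S` and under `S'` puts `w` and `u` outside the first, hence together in the
  -- second.
  have hnwv := hN.cut_not_reachable hc hw
  have hnuv : ¬ (N.cut S w).Reachable u v := fun h' =>
    hN.cut_not_reachable hc hS' (h'.of_adj fun _ _ _ => hcut.2)
  have hwu : (N.cut S w).Reachable w u :=
    (hN.cut_reachable_or hc hw (hN.below_mem h).1).resolve_right fun h' => hnuv h'.symm
  by_contra hu
  -- Follow the path from `a` to `v` that exists under `S'`. Its only possible edge outside the
  -- common forest joins `u` and `v`: arriving first at `u` contradicts `hu`, and arriving first at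
  -- `v` proves the claim.
  have hav : (N.cut S w).Reachable a v := by
    have := (hv S').closure (P := fun p => (N.cut S w).Reachable a v ∨
      (N.cut S w ⊓ N.cut S a).Reachable a p) (.inr .rfl) fun p q _ hp hpq => by
        rcases hp with hp | hp
        · exact .inl hp
        rcases hN.cut_adj.1 hpq with h' | h' | ⟨h', ha⟩ | ⟨h', ha⟩
        · exact .inr (hp.trans (SimpleGraph.Adj.reachable
            ⟨hN.cut_adj.2 (.inl h'), hN.cut_adj.2 (.inl h')⟩))
        · exact .inr (hp.trans (SimpleGraph.Adj.reachable
            ⟨hN.cut_adj.2 (.inr (.inl h')), hN.cut_adj.2 (.inr (.inl h'))⟩))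
        · by_cases hpu : p = u
          · subst hpu
            exact (hu (hp.mono inf_le_right)).elim
          · have h1 := hkey.1 ⟨h', hpu⟩
            exact .inr (hp.trans (SimpleGraph.Adj.reachable
              ⟨hN.cut_adj.2 (.inr (.inr (.inl h1))),
                hN.cut_adj.2 (.inr (.inr (.inl ⟨h1.1, ha⟩)))⟩))
        · by_cases hqu : q = u
          · subst hqu
            obtain rfl := hN.below_unique h h'.below
            exact .inl (hp.mono inf_le_left)
          · have h1 := hkey.1 ⟨h', hqu⟩
            exact .inr (hp.trans (SimpleGraph.Adj.reachable
              ⟨hN.cut_adj.2 (.inr (.inr (.inr h1))),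
                hN.cut_adj.2 (.inr (.inr (.inr ⟨h1.1, ha⟩)))⟩))
    exact this.elim id fun h' => h'.mono inf_le_left
  -- Since `a` is on the side of `v`, the part of the forest that contains `w` and `u` avoids `a`.
  -- So it survives in `N.cut S a`, where `a` reaches `v`, then `w`, then `u`.
  have hwa : ∀ {p}, (N.cut S w).Reachable w p → p ≠ a := fun {p} hp he =>
    hnwv (hp.trans (he ▸ hav))
  refine hu (((hv S).trans (hN.cut_adj.2 (.inr (.inr (.inr ⟨hw, hwa .rfl⟩)))).reachable).trans
    (hwu.of_adj fun p q hp hpq => ?_))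
  have hp' := hwa hp
  have hq' := hwa (hp.trans hpq.reachable)
  have := hN.graph_adj.1 (cut_le hpq)
  rw [hN.cut_adj]
  tauto

end WF
end Net
end MLL

/-! ### Empires and the splitting lemma -/

namespace MLL
namespace Net

variable {N : Net} {S : ℕ → Bool} {a b u v : ℕ}

/-- The vertex `u` is a premise of a `⊗`-link with conclusion `v`. -/
def TensBelow (N : Net) (u v : ℕ) : Prop := ∃ w, N.bin .tens u w v ∨ N.bin .tens w u v

theorem TensBelow.up (h : N.TensBelow u v) (S : ℕ → Bool) : N.Up S u v := by
  obtain ⟨w, h | h⟩ := h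
  · exact ⟨_, w, .inl ⟨h, nofun⟩⟩
  · exact ⟨_, w, .inr ⟨h, nofun⟩⟩

theorem TensBelow.below (h : N.TensBelow u v) : N.Below u v := (h.up fun _ => false).below

/-- A set of vertices that contains with the conclusions of a link all its premises and
conclusions. -/
def UpClosed (N : Net) (U : Set ℕ) : Prop :=
  (∀ {u v}, N.ax u v → (u ∈ U ↔ v ∈ U)) ∧ ∀ {u v}, N.Below u v → v ∈ U → u ∈ U

theorem UpClosed.mem_of_reflTransGen {U : Set ℕ} (hU : N.UpClosed U)
    (h : Relation.ReflTransGen N.Below u v) (hv : v ∈ U) : u ∈ U := by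
  induction h with
  | refl => exact hv
  | tail _ h ih => exact ih (hU.2 h hv)

/-- A vertex that is a premise of no link. -/
def Final (N : Net) (x : ℕ) : Prop := x ∈ N.verts ∧ ∀ y, ¬ N.Below x y

namespace WF

theorem tens_mem_empire (hN : N.WF) (h : N.TensBelow u v) (hu : u ∈ N.empire a) (hua : u ≠ a) :
    v ∈ N.empire a := fun S =>
  (hu S).trans (hN.cut_adj.2 (.inr (.inr (.inl ⟨h.up S, hua⟩)))).reachable

/-- Whichever premise is selected, it is reachable and its edge is kept, as it is not the one below
`a`. -/
theorem par_mem_empire (hN : N.WF) {i j k : ℕ} (h : N.bin .par i j k) (hi : i ∈ N.empire a)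
    (hj : j ∈ N.empire a) (hia : i ≠ a) (hja : j ≠ a) : k ∈ N.empire a := fun S => by
  cases hS : S k with
  | false =>
    exact (hi S).trans
      (hN.cut_adj.2 (.inr (.inr (.inl ⟨⟨_, _, .inl ⟨h, fun _ => hS⟩⟩, hia⟩)))).reachable
  | true =>
    exact (hj S).trans
      (hN.cut_adj.2 (.inr (.inr (.inl ⟨⟨_, _, .inr ⟨h, fun _ => hS⟩⟩, hja⟩)))).reachable

theorem upClosed_empire (hN : N.WF) (hc : N.Correct) (a : ℕ) : N.UpClosed (N.empire a) :=
  ⟨hN.ax_mem_empire, hN.mem_empire_of_below hc⟩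

/-- The parts of the graph above the two premises of a `⊗`-link are disjoint. -/
theorem cut_disjoint (hN : N.WF) (hc : N.Correct) {t x : ℕ} (h : N.bin .tens a b t)
    (ha : (N.cut S a).Reachable a x) : ¬ (N.cut S b).Reachable b x := fun hb => by
  have hat : N.TensBelow a t := ⟨_, .inl h⟩
  have hbt : N.TensBelow b t := ⟨_, .inr h⟩
  have hna := hN.cut_not_reachable hc (hat.up S)
  have hnb := hN.cut_not_reachable hc (hbt.up S)
  -- The component of `b` avoids `t`, so it does not use the edge from `a` to `t` and survives its
  -- deletion. A common vertex `x` would then connect `a` to `t` through `b`, although that edge is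
  -- a bridge.
  have hbx : (N.cut S a).Reachable b x := hb.of_adj fun p q hp hpq => by
    have hpt : p ≠ t := by rintro rfl; exact hnb hp
    have hqt : q ≠ t := by rintro rfl; exact hnb (hp.trans hpq.reachable)
    rw [hN.cut_adj]
    rcases hN.cut_adj.1 hpq with h' | h' | ⟨h', -⟩ | ⟨h', -⟩
    · exact .inl h'
    · exact .inr (.inl h')
    · refine .inr (.inr (.inl ⟨h', ?_⟩))
      rintro rfl
      exact hqt (hN.below_unique h'.below hat.below)
    · refine .inr (.inr (.inr ⟨h', ?_⟩))
      rintro rfl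
      exact hpt (hN.below_unique h'.below hat.below)
  exact hna ((ha.trans hbx.symm).trans (hN.cut_adj.2
    (.inr (.inr (.inl ⟨hbt.up S, (hN.premise_ne h).symm⟩)))).reachable)

theorem empire_disjoint (hN : N.WF) (hc : N.Correct) {t : ℕ} (h : N.bin .tens a b t) :
    Disjoint (N.empire a) (N.empire b) :=
  Set.disjoint_left.2 fun _ ha hb =>
    hN.cut_disjoint hc h (ha fun _ => false) (hb fun _ => false)

/-- If the empires of `a` and `b` meet and `b` is not in the empire of `a`, then the latter is
contained in the empire of `b`. -/
theorem empire_subset_empire (hN : N.WF) (hc : N.Correct) (hb : b ∉ N.empire a) {x : ℕ}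
    (hxa : x ∈ N.empire a) (hxb : x ∈ N.empire b) : N.empire a ⊆ N.empire b := by
  classical
  -- The switching is chosen such that whenever the selected premise of a ⅋-link lies in both
  -- empires and is not `a`, so does the other premise. Then a walk in `N.cut S a` that starts in
  -- the intersection can pass down through a ⅋-link only into the intersection, while this walk
  -- reaches all of the empire of `a`.
  let S : ℕ → Bool := fun k => decide (∃ i j, N.bin .par i j k ∧ i ∈ N.empire a ∧ i ≠ a ∧
    (j ∈ N.empire a → j ≠ a → i ∈ N.empire b))
  intro y hy
  have := ((hxa S).symm.trans (hy S)).closure (P := fun y => y ∈ N.empire a ∩ N.empire b)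
    ⟨hxa, hxb⟩ fun p q _ hp hpq => by
      have ne_b : ∀ {z}, z ∈ N.empire a → z ≠ b := fun hz h => hb (h ▸ hz)
      rcases hN.cut_adj.1 hpq with h | h | ⟨h, hpa⟩ | ⟨h, -⟩
      · exact ⟨(hN.ax_mem_empire h).1 hp.1, (hN.ax_mem_empire h).1 hp.2⟩
      · exact ⟨(hN.ax_mem_empire h).2 hp.1, (hN.ax_mem_empire h).2 hp.2⟩
      · have htens : N.TensBelow p q → q ∈ N.empire a ∩ N.empire b := fun h =>
          ⟨hN.tens_mem_empire h hp.1 hpa, hN.tens_mem_empire h hp.2 (ne_b hp.1)⟩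
        obtain ⟨_ | _, w, ⟨h, hS⟩ | ⟨h, hS⟩⟩ := h
        · exact htens ⟨w, .inl h⟩
        · exact htens ⟨w, .inr h⟩
        · have hS := of_decide_eq_false (hS rfl)
          push Not at hS
          exact (hS _ _ h hp.1 hpa).2.2 hp.2 |>.elim
        · obtain ⟨i, j, h', hi, hia, hj⟩ := of_decide_eq_true (hS rfl)
          obtain ⟨-, rfl, rfl⟩ := hN.bin_unique h h'
          exact ⟨hN.par_mem_empire h hi hp.1 hia hpa,
            hN.par_mem_empire h (hj hp.1 hpa) hp.2 (ne_b hi) (ne_b hp.1)⟩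
      · exact ⟨hN.mem_empire_of_below hc h.below hp.1, hN.mem_empire_of_below hc h.below hp.2⟩
  exact this.2

theorem exists_final (hN : N.WF) {x : ℕ} (hx : x ∈ N.verts) :
    ∃ y, N.Final y ∧ Relation.ReflTransGen N.Below x y := by
  obtain ⟨r, hr⟩ := hN.rank
  obtain ⟨y, ⟨hy, hxy⟩, hmax⟩ : ∃ y, (y ∈ N.verts ∧ Relation.ReflTransGen N.Below x y) ∧
      ∀ z, z ∈ N.verts ∧ Relation.ReflTransGen N.Below x z → r z ≤ r y := by
    classical
    obtain ⟨y, hy, hmax⟩ := Finset.exists_max_image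
      (N.verts.filter fun y => Relation.ReflTransGen N.Below x y) r
      ⟨x, Finset.mem_filter.2 ⟨hx, .refl⟩⟩
    exact ⟨y, Finset.mem_filter.1 hy, fun z hz => hmax z (Finset.mem_filter.2 hz)⟩
  exact ⟨y, ⟨hy, fun z hz => (hmax z ⟨(hN.below_mem hz).2, hxy.tail hz⟩).not_gt (hr hz)⟩, hxy⟩

/-- If there is no final `⅋`-link, then every conclusion of a binary link lies above the conclusion
of a final `⊗`-link. -/
theorem exists_final_tens (hN : N.WF) (hp : ∀ i j k, N.bin .par i j k → ¬ N.Final k)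
    {c : Conn} {i j k : ℕ} (h : N.bin c i j k) :
    ∃ a b t, N.bin .tens a b t ∧ N.Final t ∧ Relation.ReflTransGen N.Below k t := by
  obtain ⟨y, hy, hky⟩ := hN.exists_final (hN.bin_mem h).2.2
  have hbin : ∃ c i j, N.bin c i j y := by
    rcases hky.cases_tail with rfl | ⟨x, -, c, w, hx | hx⟩
    · exact ⟨_, _, _, h⟩
    · exact ⟨_, _, _, hx⟩
    · exact ⟨_, _, _, hx⟩
  obtain ⟨_ | _, a, b, hab⟩ := hbin
  · exact ⟨a, b, y, hab, hy, hky⟩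
  · exact (hp _ _ _ hab hy).elim

/-- A final `⊗`-link of a correct net splits it, unless there is a `⅋`-link below the empires of its
premises. -/
theorem splits_or_exists_par (hN : N.WF) (hc : N.Correct) {t : ℕ} (h : N.bin .tens a b t)
    (ht : N.Final t) : (N.verts : Set ℕ) = N.empire a ∪ N.empire b ∪ {t} ∨
      ∃ p k, N.Below p k ∧ (∃ i j, N.bin .par i j k) ∧ (p ∈ N.empire a ∨ p ∈ N.empire b) ∧
        k ∉ N.empire a ∪ N.empire b ∪ {t} := by
  by_contra hcon
  push Not at hcon
  obtain ⟨hne, hpar⟩ := hcon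
  have ha := (hN.bin_mem h).1
  have hb := (hN.bin_mem h).2.1
  have hsub : N.empire a ∪ N.empire b ∪ {t} ⊆ (N.verts : Set ℕ) :=
    Set.union_subset (Set.union_subset (hN.empire_subset ha) (hN.empire_subset hb))
      (Set.singleton_subset_iff.2 ht.1)
  refine hne (subset_antisymm (fun x hx => ?_) hsub)
  -- Without an outgoing ⅋-link the union of the empires and `t` is closed under all edges of a
  -- connected graph.
  refine ((hc fun _ => false).reachable ha hx).closure
    (P := fun y => y ∈ N.empire a ∪ N.empire b ∪ {t}) (.inl (.inl (mem_empire_self N a)))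
    fun p q _ hp hpq => ?_
  have hbelow : N.Below a t ∧ N.Below b t := ⟨⟨_, _, .inl h⟩, ⟨_, _, .inr h⟩⟩
  rcases hN.graph_adj.1 hpq with h' | h' | h' | h'
  · rcases hp with (hp | hp) | rfl
    · exact .inl (.inl ((hN.ax_mem_empire h').1 hp))
    · exact .inl (.inr ((hN.ax_mem_empire h').1 hp))
    · exact ((hN.ax_not_below h' _).1 hbelow.1).elim
  · rcases hp with (hp | hp) | rfl
    · exact .inl (.inl ((hN.ax_mem_empire h').2 hp))
    · exact .inl (.inr ((hN.ax_mem_empire h').2 hp))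
    · exact ((hN.ax_not_below h' _).2 hbelow.1).elim
  · have hup : p ∈ N.empire a ∨ p ∈ N.empire b → q ∈ N.empire a ∪ N.empire b ∪ {t} := by
      intro hp
      by_contra hq
      have hpq' := h'.below
      by_cases hex : ∃ i j, N.bin .par i j q
      · exact hq (hpar p q hpq' hex hp)
      have htens : N.TensBelow p q := by
        obtain ⟨_ | _, w, h1 | h1⟩ := hpq'
        · exact ⟨w, .inl h1⟩
        · exact ⟨w, .inr h1⟩
        · exact (hex ⟨_, _, h1⟩).elim
        · exact (hex ⟨_, _, h1⟩).elim
      apply hq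
      rcases hp with hp | hp
      · by_cases hpa : p = a
        · exact .inr (hN.below_unique hpq' (hpa ▸ hbelow.1))
        · exact .inl (.inl (hN.tens_mem_empire htens hp hpa))
      · by_cases hpb : p = b
        · exact .inr (hN.below_unique hpq' (hpb ▸ hbelow.2))
        · exact .inl (.inr (hN.tens_mem_empire htens hp hpb))
    rcases hp with hp | rfl
    · exact hup hp
    · exact (ht.2 _ h'.below).elim
  · rcases hp with (hp | hp) | rfl
    · exact .inl (.inl (hN.mem_empire_of_below hc h'.below hp))
    · exact .inl (.inr (hN.mem_empire_of_below hc h'.below hp))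
    · obtain ⟨c, w, h1 | h1⟩ := h'.below
      · obtain ⟨-, rfl, -⟩ := hN.bin_unique h h1
        exact .inl (.inl (mem_empire_self N _))
      · obtain ⟨-, -, rfl⟩ := hN.bin_unique h h1
        exact .inl (.inr (mem_empire_self N _))

/-- The splitting lemma: a correct net without final `⅋`-links, but with some binary link, has
a final `⊗`-link that splits it. -/
theorem exists_splitting (hN : N.WF) (hc : N.Correct)
    (hp : ∀ i j k, N.bin .par i j k → ¬ N.Final k) {c : Conn} {i j k : ℕ} (h : N.bin c i j k) :
    ∃ a b t, N.bin .tens a b t ∧ N.Final t ∧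
      (N.verts : Set ℕ) = N.empire a ∪ N.empire b ∪ {t} := by
  obtain ⟨a₀, b₀, t₀, h₀, hf₀, -⟩ := hN.exists_final_tens hp h
  -- Among the final ⊗-links, take one whose two empires have the largest union. If it does not
  -- split the net, a ⅋-link leaves this union, and below it there is a final ⊗-link with a larger
  -- union.
  obtain ⟨⟨a, b, t⟩, ⟨hab, hf⟩, hmax⟩ : ∃ z : ℕ × ℕ × ℕ,
      (N.bin .tens z.1 z.2.1 z.2.2 ∧ N.Final z.2.2) ∧
      ∀ z' : ℕ × ℕ × ℕ, N.bin .tens z'.1 z'.2.1 z'.2.2 ∧ N.Final z'.2.2 →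
        (N.empire z'.1 ∪ N.empire z'.2.1).ncard ≤ (N.empire z.1 ∪ N.empire z.2.1).ncard := by
    classical
    obtain ⟨z, hz, hmax⟩ := Finset.exists_max_image
      ((N.verts ×ˢ N.verts ×ˢ N.verts).filter fun z : ℕ × ℕ × ℕ =>
        N.bin .tens z.1 z.2.1 z.2.2 ∧ N.Final z.2.2)
      (fun z => (N.empire z.1 ∪ N.empire z.2.1).ncard)
      ⟨(a₀, b₀, t₀), by simp [h₀, hf₀, hN.bin_mem h₀]⟩
    refine ⟨z, (Finset.mem_filter.1 hz).2, fun z' hz' => hmax z' ?_⟩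
    simp only [Finset.mem_filter, Finset.mem_product]
    exact ⟨hN.bin_mem hz'.1, hz'⟩
  refine ⟨a, b, t, hab, hf, (hN.splits_or_exists_par hc hab hf).resolve_right ?_⟩
  rintro ⟨p, k, hpk, ⟨i, j, hk⟩, hpE, hkE⟩
  obtain ⟨a', b', t', hab', hf', hkt⟩ := hN.exists_final_tens hp hk
  obtain ⟨x, hkx, hx⟩ : ∃ x, Relation.ReflTransGen N.Below k x ∧ N.Below x t' := by
    rcases hkt.cases_tail with rfl | h
    · exact nomatch (hN.bin_unique hab' hk).1
    · exact h
  have hxab : x = a' ∨ x = b' := by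
    obtain ⟨c, w, h1 | h1⟩ := hx
    · exact .inl (hN.bin_unique h1 hab').2.1
    · exact .inr (hN.bin_unique h1 hab').2.2
  have hkx' : k ∈ N.empire x :=
    (hN.upClosed_empire hc x).mem_of_reflTransGen hkx (mem_empire_self N x)
  have hpx := hN.mem_empire_of_below hc hpk hkx'
  have hxa : x ∉ N.empire a := fun hxa =>
    hkE (.inl (.inl ((hN.upClosed_empire hc a).mem_of_reflTransGen hkx hxa)))
  have hxb : x ∉ N.empire b := fun hxb =>
    hkE (.inl (.inr ((hN.upClosed_empire hc b).mem_of_reflTransGen hkx hxb)))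
  have ha : N.TensBelow a t := ⟨_, .inl hab⟩
  have hb : N.TensBelow b t := ⟨_, .inr hab⟩
  -- The vertex `p` lies in the empire of `x` and in that of `a` or `b`. As `x` is in neither of the
  -- latter, that empire is contained in the one of `x`, which then also contains `t`, hence both
  -- premises of `t`, hence both empires.
  have htx : t ∈ N.empire x := by
    rcases hpE with hpE | hpE
    · exact hN.tens_mem_empire ha (hN.empire_subset_empire hc hxa hpE hpx (mem_empire_self N a))
        fun h => hxa (h ▸ mem_empire_self N a)
    · exact hN.tens_mem_empire hb (hN.empire_subset_empire hc hxb hpE hpx (mem_empire_self N b))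
        fun h => hxb (h ▸ mem_empire_self N b)
  have hax := hN.empire_subset_empire hc hxa (mem_empire_self N a)
    (hN.mem_empire_of_below hc ha.below htx)
  have hbx := hN.empire_subset_empire hc hxb (mem_empire_self N b)
    (hN.mem_empire_of_below hc hb.below htx)
  have hx' : N.empire x ⊆ N.empire a' ∪ N.empire b' := by
    rcases hxab with rfl | rfl
    · exact Set.subset_union_left
    · exact Set.subset_union_right
  have hfin : (N.empire a' ∪ N.empire b').Finite := N.verts.finite_toSet.subset
    (Set.union_subset (hN.empire_subset (hN.bin_mem hab').1)
      (hN.empire_subset (hN.bin_mem hab').2.1))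
  -- The inclusion is strict because `t` belongs to the new union but to neither of the empires of
  -- its own premises.
  refine (hmax (a', b', t') ⟨hab', hf'⟩).not_gt (Set.ncard_lt_ncard ⟨?_, fun hsub => ?_⟩ hfin)
  · exact (Set.union_subset hax hbx).trans hx'
  · rcases hsub (hx' htx) with h | h
    · exact hN.not_mem_empire_of_below hc ha.below h
    · exact hN.not_mem_empire_of_below hc hb.below h

end WF
end Net
end MLL

/-! ### Exchanging two connectives in a net -/

namespace MLL
namespace Net

variable {N : Net} {S S' : ℕ → Bool} {u v : ℕ}

/-- The net with the connectives of the links with conclusions `t` and `q` replaced by their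
duals. -/
def flip (N : Net) (t q : ℕ) : Net where
  verts := N.verts
  ax := N.ax
  bin c i j k := N.bin (if k = t ∨ k = q then c.flip else c) i j k

theorem graph_congr (h : ∀ i j k, N.bin .par i j k → S k = S' k) : N.graph S = N.graph S' := by
  have : N.Up S = N.Up S' := by
    funext u v
    refine propext (exists_congr fun c => exists_congr fun w => or_congr ?_ ?_)
    · exact and_congr_right fun hb => forall_congr' fun hc => by rw [h _ _ _ (hc ▸ hb)]
    · exact and_congr_right fun hb => forall_congr' fun hc => by rw [h _ _ _ (hc ▸ hb)]
  rw [graph, graph, this]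

theorem cut_congr (h : ∀ i j k, N.bin .par i j k → S k = S' k) (a : ℕ) :
    N.cut S a = N.cut S' a := by
  rw [cut, cut, graph_congr h]

theorem flip_below {t q : ℕ} : (N.flip t q).Below u v ↔ N.Below u v := by
  constructor
  · rintro ⟨c, w, h⟩
    exact ⟨_, w, h⟩
  · rintro ⟨c, w, h⟩
    refine ⟨if v = t ∨ v = q then c.flip else c, w, ?_⟩
    have : (if v = t ∨ v = q then (if v = t ∨ v = q then c.flip else c).flip
        else if v = t ∨ v = q then c.flip else c) = c := by
      split_ifs <;> cases c <;> rfl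
    simpa only [flip, this] using h

namespace WF

variable {a b t c d q : ℕ}

theorem flip (hN : N.WF) (t q : ℕ) : (N.flip t q).WF where
  ax_mem h := hN.ax_mem h
  bin_mem h := hN.bin_mem h
  ax_ne h := hN.ax_ne h
  premise_ne h := hN.premise_ne h
  rank := by
    obtain ⟨r, hr⟩ := hN.rank
    exact ⟨r, fun h => hr (flip_below.1 h)⟩
  below_unique h h' := hN.below_unique (flip_below.1 h) (flip_below.1 h')
  bin_unique {c i j k c' i' j'} h h' := by
    obtain ⟨h1, h2, h3⟩ := hN.bin_unique h h'
    refine ⟨?_, h2, h3⟩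
    split_ifs at h1
    · cases c <;> cases c' <;> first | rfl | exact nomatch h1
    · exact h1
  ax_not_bin h c x y := ⟨(hN.ax_not_bin h _ _ _).1, (hN.ax_not_bin h _ _ _).2⟩
  cover {x} hx := by
    refine (hN.cover hx).imp_right ?_
    rintro ⟨c, i, j, h⟩
    obtain ⟨c', w, h' | h'⟩ := (flip_below (t := t) (q := q)).2 ⟨c, j, .inl h⟩
    · exact ⟨_, _, _, h'⟩
    · exact ⟨_, _, _, h'⟩

theorem up_iff (hN : N.WF) {k : Conn} {i j : ℕ} (hb : N.bin k i j v) :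
    N.Up S u v ↔ u = i ∧ (k = .par → S v = false) ∨ u = j ∧ (k = .par → S v = true) := by
  refine ⟨fun h => hN.up_total h hb, ?_⟩
  rintro (⟨rfl, h⟩ | ⟨rfl, h⟩)
  · exact ⟨_, _, .inl ⟨hb, h⟩⟩
  · exact ⟨_, _, .inr ⟨hb, h⟩⟩

/-- The graph of a net as the graph without the edge below `a`, and that edge. -/
theorem graph_eq_cut_sup_edge (hN : N.WF) (h : N.Up S a v) :
    N.graph S = N.cut S a ⊔ SimpleGraph.edge a v := by
  ext p r
  rw [SimpleGraph.sup_adj, SimpleGraph.edge_adj, hN.graph_adj, hN.cut_adj]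
  have key : ∀ {p r}, N.Up S p r ↔ N.Up S p r ∧ p ≠ a ∨ p = a ∧ r = v := fun {p r} => by
    constructor
    · intro h'
      by_cases hp : p = a
      · subst hp
        exact .inr ⟨rfl, hN.below_unique h'.below h.below⟩
      · exact .inl ⟨h', hp⟩
    · rintro (h' | ⟨rfl, rfl⟩)
      · exact h'.1
      · exact h
  have hne := hN.below_ne h.below
  constructor
  · rintro (h | h | h | h)
    · exact .inl (.inl h)
    · exact .inl (.inr (.inl h))
    · rcases key.1 h with h | h
      · exact .inl (.inr (.inr (.inl h)))
      · exact .inr ⟨.inl h, by rwa [h.1, h.2]⟩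
    · rcases key.1 h with h | h
      · exact .inl (.inr (.inr (.inr h)))
      · exact .inr ⟨.inr h.symm, by rw [h.1, h.2]; exact hne.symm⟩
  · have key1 := key (p := p) (r := r)
    have key2 := key (p := r) (r := p)
    tauto

/-- The graph of the flipped net arises by replacing one edge above `t` by one edge above `q`. -/
theorem flip_graph (hN : N.WF) (ht : N.bin .tens a b t) (hq : N.bin .par c d q) {x z : ℕ}
    (hx : x = a ∧ S t = true ∨ x = b ∧ S t = false)
    (hz : z = c ∧ S q = true ∨ z = d ∧ S q = false) :
    (N.flip t q).graph S = N.cut S x ⊔ SimpleGraph.edge z q := by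
  have htq : t ≠ q := by
    rintro rfl
    exact nomatch (hN.bin_unique ht hq).1
  have hat : N.Below a t := ⟨_, _, .inl ht⟩
  have hbt : N.Below b t := ⟨_, _, .inr ht⟩
  have hcq : N.Below c q := ⟨_, _, .inl hq⟩
  have hdq : N.Below d q := ⟨_, _, .inr hq⟩
  have hxt : N.Below x t := by
    rcases hx with ⟨rfl, -⟩ | ⟨rfl, -⟩ <;> assumption
  have hzq : N.Below z q := by
    rcases hz with ⟨rfl, -⟩ | ⟨rfl, -⟩ <;> assumption
  have hab := hN.premise_ne ht
  have hne : ∀ {y}, N.Below y q → y ≠ x := by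
    rintro y hy rfl
    exact htq (hN.below_unique hxt hy)
  have hne1 := hne hcq
  have hne2 := hne hdq
  -- The value `true` selects the right premise. So `x` is the premise of `t` that `S` drops once
  -- the link is a ⅋-link, and `z` the premise of `q` that `S` drops while that link is still a
  -- ⅋-link.
  have key : ∀ {p r}, (N.flip t q).Up S p r ↔ N.Up S p r ∧ p ≠ x ∨ p = z ∧ r = q := by
    intro p r
    by_cases hrt : r = t
    · subst hrt
      have ht' : (N.flip r q).bin .par a b r := by simpa [Net.flip, Conn.flip] using ht
      rw [(hN.flip r q).up_iff ht', hN.up_iff ht]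
      rcases hx with ⟨rfl, hS⟩ | ⟨rfl, hS⟩ <;> simp [hS, htq] <;> aesop
    by_cases hrq : r = q
    · subst hrq
      have hq' : (N.flip t r).bin .tens c d r := by simpa [Net.flip, Conn.flip] using hq
      rw [(hN.flip t r).up_iff hq', hN.up_iff hq]
      rcases hz with ⟨rfl, hS⟩ | ⟨rfl, hS⟩ <;> simp [hS] <;> aesop
    · have : (N.flip t q).Up S p r ↔ N.Up S p r := by
        simp only [Up, Net.flip, hrt, hrq, or_self, if_false]
      rw [this]
      constructor
      · refine fun h => .inl ⟨h, ?_⟩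
        rintro rfl
        exact hrt (hN.below_unique h.below hxt)
      · tauto
  ext p r
  rw [SimpleGraph.sup_adj, SimpleGraph.edge_adj, (hN.flip t q).graph_adj, hN.cut_adj,
    key (p := p), key (p := r)]
  have hne := hN.below_ne hzq
  constructor
  · rintro (h | h | (h | ⟨rfl, rfl⟩) | (h | ⟨rfl, rfl⟩))
    · exact .inl (.inl h)
    · exact .inl (.inr (.inl h))
    · exact .inl (.inr (.inr (.inl h)))
    · exact .inr ⟨.inl ⟨rfl, rfl⟩, hne⟩
    · exact .inl (.inr (.inr (.inr h)))
    · exact .inr ⟨.inr ⟨rfl, rfl⟩, hne.symm⟩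
  · rintro ((h | h | h | h) | ⟨h | h, -⟩)
    · exact .inl h
    · exact .inr (.inl h)
    · exact .inr (.inr (.inl (.inl h)))
    · exact .inr (.inr (.inr (.inl h)))
    · exact .inr (.inr (.inl (.inr h)))
    · exact .inr (.inr (.inr (.inr h.symm)))

/-- By the exchange of an edge in a tree, the new graph is a tree exactly when the inserted edge
joins different components of `N.cut S x`. Its lower end `q` remains attached to the other, selected
premise, so this amounts to separating `c` from `d`. -/
theorem flip_isTreeOn_iff (hN : N.WF) (hc : N.Correct) (ht : N.bin .tens a b t)
    (hq : N.bin .par c d q) {x : ℕ} (hx : x = a ∧ S t = true ∨ x = b ∧ S t = false) :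
    ((N.flip t q).graph S).IsTreeOn (N.flip t q).verts ↔ ¬ (N.cut S x).Reachable c d := by
  have htq : t ≠ q := by
    rintro rfl
    exact nomatch (hN.bin_unique ht hq).1
  have hxt : N.Up S x t := by
    rcases hx with ⟨rfl, -⟩ | ⟨rfl, -⟩
    · exact TensBelow.up ⟨_, .inl ht⟩ S
    · exact TensBelow.up ⟨_, .inr ht⟩ S
  have hcd := hN.premise_ne hq
  obtain ⟨z, z', hz, hz', hzz'⟩ : ∃ z z', (z = c ∧ S q = true ∨ z = d ∧ S q = false) ∧
      N.Up S z' q ∧ (z = c ∧ z' = d ∨ z = d ∧ z' = c) := by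
    cases hS : S q with
    | false => exact ⟨d, c, .inr ⟨rfl, rfl⟩, ⟨_, _, .inl ⟨hq, fun _ => hS⟩⟩, .inr ⟨rfl, rfl⟩⟩
    | true => exact ⟨c, d, .inl ⟨rfl, rfl⟩, ⟨_, _, .inr ⟨hq, fun _ => hS⟩⟩, .inl ⟨rfl, rfl⟩⟩
  have hzq : N.Below z q := by
    rcases hz with ⟨rfl, -⟩ | ⟨rfl, -⟩
    · exact ⟨_, _, .inl hq⟩
    · exact ⟨_, _, .inr hq⟩
  have hnup : ¬ N.Up S z q := by
    rw [hN.up_iff hq]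
    rcases hz with ⟨rfl, hS⟩ | ⟨rfl, hS⟩ <;> simp [hS, hcd, hcd.symm]
  have hnadj : ¬ (N.cut S x).Adj z q := by
    rw [hN.cut_adj]
    rintro (h | h | h | h)
    · exact (hN.ax_not_below h _).2 hzq
    · exact (hN.ax_not_below h _).1 hzq
    · exact hnup h.1
    · exact hN.below_asymm hzq h.1.below
  rw [hN.flip_graph ht hq hx hz]
  have htree := hc S
  rw [hN.graph_eq_cut_sup_edge hxt] at htree
  refine (htree.exchange (hN.below_ne hxt.below) (hN.below_mem hzq).1 (hN.below_mem hzq).2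
    (hN.below_ne hzq) hnadj).trans (not_congr ?_)
  have hadj : (N.cut S x).Reachable z' q := by
    refine (hN.cut_adj.2 (.inr (.inr (.inl ⟨hz', ?_⟩)))).reachable
    rintro rfl
    exact htq (hN.below_unique hxt.below hz'.below)
  have : (N.cut S x).Reachable z q ↔ (N.cut S x).Reachable z z' :=
    ⟨fun h => h.trans hadj.symm, fun h => h.trans hadj⟩
  rw [this]
  rcases hzz' with ⟨rfl, rfl⟩ | ⟨rfl, rfl⟩
  · rfl
  · exact SimpleGraph.reachable_comm

/-- The correctness of the flipped net, one switching at a time. -/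
theorem flip_correct_iff_forall (hN : N.WF) (hc : N.Correct) (ht : N.bin .tens a b t)
    (hq : N.bin .par c d q) : (N.flip t q).Correct ↔
      ∀ S, ((N.cut S a).Reachable a c ∧ (N.cut S b).Reachable b d) ∨
        ((N.cut S a).Reachable a d ∧ (N.cut S b).Reachable b c) := by
  have h1 : (N.flip t q).Correct ↔
      ∀ S, ¬ (N.cut S a).Reachable c d ∧ ¬ (N.cut S b).Reachable c d := by
    constructor
    · intro h S
      -- In `N` the link at `t` is a ⊗-link, so the value of the switching there is free and can be
      -- used to choose which of `a`, `b` is cut off in the flipped net.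
      have hcong : ∀ (y : Bool) x, N.cut (Function.update S t y) x = N.cut S x := fun y x => by
        refine cut_congr (fun i j k hk => ?_) x
        rw [Function.update_of_ne]
        rintro rfl
        exact nomatch (hN.bin_unique ht hk).1
      constructor
      · rw [← hcong true]
        exact (hN.flip_isTreeOn_iff hc ht hq (.inl ⟨rfl, by simp⟩)).1 (h _)
      · rw [← hcong false]
        exact (hN.flip_isTreeOn_iff hc ht hq (.inr ⟨rfl, by simp⟩)).1 (h _)
    · intro h S
      cases hS : S t with
      | true => exact (hN.flip_isTreeOn_iff hc ht hq (.inl ⟨rfl, hS⟩)).2 (h S).1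
      | false => exact (hN.flip_isTreeOn_iff hc ht hq (.inr ⟨rfl, hS⟩)).2 (h S).2
  rw [h1]
  refine forall_congr' fun S => ?_
  have hat : N.TensBelow a t := ⟨_, .inl ht⟩
  have hbt : N.TensBelow b t := ⟨_, .inr ht⟩
  have hcm := (hN.bin_mem hq).1
  have hdm := (hN.bin_mem hq).2.1
  have hdisj := fun x => hN.cut_disjoint (S := S) (x := x) hc ht
  constructor
  -- Cutting below `a` leaves two components, that of `a` and that of `t`, so exactly one of `c`,
  -- `d` is with `a`. The same holds for `b`, and disjointness of the components forces different
  -- choices.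
  · rintro ⟨ha, hb⟩
    have ha' : (N.cut S a).Reachable a c ∨ (N.cut S a).Reachable a d := by
      by_contra hcon
      push Not at hcon
      exact ha (((hN.cut_reachable_or hc (hat.up S) hcm).resolve_left hcon.1).symm.trans
        ((hN.cut_reachable_or hc (hat.up S) hdm).resolve_left hcon.2))
    have hb' : (N.cut S b).Reachable b c ∨ (N.cut S b).Reachable b d := by
      by_contra hcon
      push Not at hcon
      exact hb (((hN.cut_reachable_or hc (hbt.up S) hcm).resolve_left hcon.1).symm.trans
        ((hN.cut_reachable_or hc (hbt.up S) hdm).resolve_left hcon.2))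
    rcases ha' with ha' | ha' <;> rcases hb' with hb' | hb'
    · exact (hdisj _ ha' hb').elim
    · exact .inl ⟨ha', hb'⟩
    · exact .inr ⟨ha', hb'⟩
    · exact (hdisj _ ha' hb').elim
  · rintro (⟨ha, hb⟩ | ⟨ha, hb⟩)
    · exact ⟨fun h => hdisj _ (ha.trans h) hb, fun h => hdisj _ ha (hb.trans h.symm)⟩
    · exact ⟨fun h => hdisj _ (ha.trans h.symm) hb, fun h => hdisj _ ha (hb.trans h)⟩

/-- The component above one of the two premises of a `⊗`-link can only grow when a switching is
changed at a single link. -/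
theorem cut_reachable_update (hN : N.WF) (hc : N.Correct) (ht : N.bin .tens a b t) (k : ℕ)
    (y : Bool) :
    (∀ x, (N.cut S a).Reachable a x → (N.cut (Function.update S k y) a).Reachable a x) ∨
      ∀ x, (N.cut S b).Reachable b x → (N.cut (Function.update S k y) b).Reachable b x := by
  by_cases hk : ∃ i j, N.bin .par i j k
  · obtain ⟨i, j, hk⟩ := hk
    obtain ⟨o, ho⟩ : ∃ o, ∀ p, N.Up S p k → p = o := by
      cases hS : S k with
      | false => exact ⟨i, fun p hp => by simpa [hN.up_iff hk, hS] using hp⟩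
      | true => exact ⟨j, fun p hp => by simpa [hN.up_iff hk, hS] using hp⟩
    -- The only edge that the change can remove joins `o`, the premise selected by `S`, to `k`. A
    -- component without `o` loses nothing.
    have key : ∀ {x}, ¬ (N.cut S x).Reachable x o → ∀ z, (N.cut S x).Reachable x z →
        (N.cut (Function.update S k y) x).Reachable x z := by
      intro x hx z hz
      have hup : ∀ {p r}, (N.cut S x).Reachable x p → N.Up S p r →
          N.Up (Function.update S k y) p r := by
        intro p r hp hpr
        have hr : r ≠ k := by
          rintro rfl
          exact hx (ho p hpr ▸ hp)
        simpa only [Up, Function.update_of_ne hr] using hpr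
      refine hz.of_adj fun p r hp hpr => ?_
      have hr := hp.trans hpr.reachable
      rw [hN.cut_adj] at hpr ⊢
      rcases hpr with h | h | h | h
      · exact .inl h
      · exact .inr (.inl h)
      · exact .inr (.inr (.inl ⟨hup hp h.1, h.2⟩))
      · exact .inr (.inr (.inr ⟨hup hr h.1, h.2⟩))
    by_cases hao : (N.cut S a).Reachable a o
    · exact .inr (key (hN.cut_disjoint hc ht hao))
    · exact .inl (key hao)
  · refine .inl fun x hx => ?_
    rwa [← cut_congr (S := S)]
    intro i j l hl
    rw [Function.update_of_ne]
    rintro rfl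
    exact hk ⟨i, j, hl⟩

/-- If a property of switchings is preserved under changes at a single link and depends only on the
values at the `⅋`-links, then it holds for all switchings or for none. -/
theorem switching_induction (hN : N.WF) {P : (ℕ → Bool) → Prop}
    (hcongr : ∀ S S', (∀ i j k, N.bin .par i j k → S k = S' k) → P S → P S')
    (hupdate : ∀ S k y, P S → P (Function.update S k y)) {S S' : ℕ → Bool} (h : P S) : P S' := by
  classical
  -- The values of `S'` are adopted one vertex at a time. The finite set of vertices suffices, since
  -- it contains the conclusions of all ⅋-links.
  have key : ∀ F : Finset ℕ, P fun k => if k ∈ F then S' k else S k := by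
    intro F
    induction F using Finset.induction_on with
    | empty => simpa using h
    | insert k F hk ih =>
      convert! hupdate _ k (S' k) ih using 1
      funext l
      by_cases hl : l = k
      · subst hl; simp
      · simp [hl]
  refine hcongr _ _ (fun i j k hk => ?_) (key N.verts)
  simp [(hN.bin_mem hk).2.2]

/-- The exchange of the connectives of a `⊗`-link and a `⅋`-link preserves correctness if and only
if the premises of the latter lie in the two empires of the premises of the former. -/
theorem flip_correct_iff (hN : N.WF) (hc : N.Correct) (ht : N.bin .tens a b t)
    (hq : N.bin .par c d q) : (N.flip t q).Correct ↔
      (c ∈ N.empire a ∧ d ∈ N.empire b) ∨ (d ∈ N.empire a ∧ c ∈ N.empire b) := by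
  rw [hN.flip_correct_iff_forall hc ht hq]
  have one : ∀ {x y}, (∀ S, ((N.cut S a).Reachable a x ∧ (N.cut S b).Reachable b y) ∨
        ((N.cut S a).Reachable a y ∧ (N.cut S b).Reachable b x)) → ∀ {S},
      ((N.cut S a).Reachable a x ∧ (N.cut S b).Reachable b y) →
      x ∈ N.empire a ∧ y ∈ N.empire b := by
    intro x y h S hS
    rw [empire, empire, Set.mem_ofPred_eq, Set.mem_ofPred_eq, ← forall_and]
    refine fun S' => hN.switching_induction
      (P := fun S => (N.cut S a).Reachable a x ∧ (N.cut S b).Reachable b y) ?_ ?_ hS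
    · intro S S' hSS' h
      rwa [← cut_congr hSS', ← cut_congr hSS']
    -- After a single change one of the two components has kept its vertices, so `x` is still with
    -- `a` or `y` still with `b`. Either excludes the swapped alternative by disjointness.
    · intro S k e hP
      refine (h (Function.update S k e)).resolve_right fun h' => ?_
      rcases hN.cut_reachable_update (S := S) hc ht k e with hg | hg
      · exact hN.cut_disjoint hc ht (hg _ hP.1) h'.2
      · exact hN.cut_disjoint hc ht h'.1 (hg _ hP.2)
  constructor
  · intro h
    rcases h fun _ => false with h' | h'
    · exact .inl (one h h')
    · exact .inr (one (fun S => (h S).symm) h')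
  · rintro (h | h) S
    · exact .inl ⟨h.1 S, h.2 S⟩
    · exact .inr ⟨h.1 S, h.2 S⟩

end WF
end Net
end MLL

/-! ### Restricting, extending and joining correct nets -/

namespace MLL
namespace Net

variable {N N₁ N₂ : Net} {S : ℕ → Bool} {u v : ℕ} {U : Set ℕ}

open Classical in
/-- The part of a net over a set of vertices that is closed upwards. -/
noncomputable def restrict (N : Net) (U : Set ℕ) : Net where
  verts := N.verts.filter (· ∈ U)
  ax i j := N.ax i j ∧ i ∈ U ∧ j ∈ U
  bin c i j k := N.bin c i j k ∧ k ∈ U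

theorem restrict_up : (N.restrict U).Up S u v ↔ N.Up S u v ∧ v ∈ U := by
  simp only [Up, restrict]
  grind

theorem UpClosed.restrict_graph_adj (hU : N.UpClosed U) :
    ((N.restrict U).graph S).Adj u v ↔ (N.graph S).Adj u v ∧ u ∈ U ∧ v ∈ U := by
  simp only [graph, SimpleGraph.fromRel_adj, restrict_up]
  have h1 := fun h : N.Up S u v => hU.2 h.below
  have h2 := fun h : N.Up S v u => hU.2 h.below
  simp only [restrict]
  tauto

/-- The restriction of a correct net to an upwards closed set is correct if all its graphs are
connected. -/
theorem Correct.restrict (hc : N.Correct) (hU : N.UpClosed U)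
    (h : ∀ S, ∃ x, ∃ G ≤ N.graph S, (∀ y, G.Reachable x y → y ∈ U) ∧
      ∀ y ∈ N.verts, y ∈ U → G.Reachable x y) : (N.restrict U).Correct := by
  intro S
  have hle : (N.restrict U).graph S ≤ N.graph S := fun _ _ h => (hU.restrict_graph_adj.1 h).1
  refine ⟨fun {u v} huv => ?_, fun {u v} hu hv => ?_, (hc S).acyclic.anti hle⟩
  · have h' := hU.restrict_graph_adj.1 huv
    simpa [Net.restrict] using ⟨(hc S).mem h'.1, h'.2.1⟩
  · obtain ⟨x, G, hG, hGU, hx⟩ := h S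
    have key : ∀ {y}, y ∈ N.verts ∧ y ∈ U → ((N.restrict U).graph S).Reachable x y := fun hy =>
      (hx _ hy.1 hy.2).of_adj fun p q hp hpq =>
        hU.restrict_graph_adj.2 ⟨hG hpq, hGU _ hp, hGU _ (hp.trans hpq.reachable)⟩
    have hu : u ∈ N.verts ∧ u ∈ U := by simpa [Net.restrict] using hu
    have hv : v ∈ N.verts ∧ v ∈ U := by simpa [Net.restrict] using hv
    exact (key hu).symm.trans (key hv)

namespace WF

/-- Removing a final `⅋`-link preserves correctness. -/
theorem correct_remove_par (hN : N.WF) (hc : N.Correct) {i j k : ℕ} (h : N.bin .par i j k)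
    (hk : N.Final k) : N.UpClosed {k}ᶜ ∧ (N.restrict {k}ᶜ).Correct := by
  have hU : N.UpClosed {k}ᶜ := by
    refine ⟨fun {u v} h' => ?_, fun {u v} h' _ => ?_⟩
    · have h1 : u ≠ k := by
        rintro rfl
        exact (hN.ax_not_bin h' _ _ _).1 h
      have h2 : v ≠ k := by
        rintro rfl
        exact (hN.ax_not_bin h' _ _ _).2 h
      simp [h1, h2]
    · rintro rfl
      exact hk.2 _ h'
  refine ⟨hU, hc.restrict hU fun S => ?_⟩
  obtain ⟨x, hx, hx'⟩ : ∃ x, N.Up S x k ∧ ∀ y, N.Up S y k → y = x := by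
    cases hS : S k with
    | false => exact ⟨i, by simp [hN.up_iff h, hS], fun y hy => by simpa [hN.up_iff h, hS] using hy⟩
    | true => exact ⟨j, by simp [hN.up_iff h, hS], fun y hy => by simpa [hN.up_iff h, hS] using hy⟩
  refine ⟨x, N.cut S x, cut_le, ?_, fun y hy hyk => ?_⟩
  · rintro y hy rfl
    exact hN.cut_not_reachable hc hx hy
  -- The vertex `k` is final and its only edge comes from the selected premise `x`, so without that
  -- edge it is isolated.
  · refine (hN.cut_reachable_or hc hx hy).resolve_right fun hr => hyk ?_
    refine hr.closure (P := fun y => y = k) rfl ?_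
    rintro p q - rfl hpq
    rcases hN.cut_adj.1 hpq with h' | h' | h' | h'
    · exact ((hN.ax_not_bin h' _ _ _).1 h).elim
    · exact ((hN.ax_not_bin h' _ _ _).2 h).elim
    · exact (hk.2 _ h'.1.below).elim
    · exact (h'.2 (hx' _ h'.1)).elim

/-- The parts of a correct net above the premises of a splitting `⊗`-link are correct. -/
theorem correct_restrict_empire (hN : N.WF) (hc : N.Correct) {a b t : ℕ} (h : N.bin .tens a b t)
    (hs : (N.verts : Set ℕ) = N.empire a ∪ N.empire b ∪ {t}) :
    (N.restrict (N.empire a)).Correct ∧ (N.restrict (N.empire b)).Correct := by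
  -- By the splitting, the component of `a` has vertices only in the two empires and `t`.
  -- Disjointness excludes the empire of `b` and the bridge property excludes `t`, so for every
  -- switching the component is the whole empire; likewise for `b`.
  have hmem : ∀ {S x y}, x ∈ N.verts → (N.cut S x).Reachable x y →
      y ∈ N.empire a ∪ N.empire b ∪ {t} := fun {S x y} hx hy => hs ▸
    hy.mem_of_closed (fun _ _ h => hN.graph_adj_mem (cut_le h)) hx
  have hat : N.TensBelow a t := ⟨_, .inl h⟩
  have hbt : N.TensBelow b t := ⟨_, .inr h⟩
  constructor
  · refine hc.restrict (hN.upClosed_empire hc a) fun S => ⟨a, N.cut S a, cut_le, fun y hy => ?_,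
      fun y _ hy => hy S⟩
    rcases hmem (hN.bin_mem h).1 hy with (h' | h') | rfl
    · exact h'
    · exact (hN.cut_disjoint hc h hy (h' S)).elim
    · exact (hN.cut_not_reachable hc (hat.up S) hy).elim
  · refine hc.restrict (hN.upClosed_empire hc b) fun S => ⟨b, N.cut S b, cut_le, fun y hy => ?_,
      fun y _ hy => hy S⟩
    rcases hmem (hN.bin_mem h).2.1 hy with (h' | h') | rfl
    · exact (hN.cut_disjoint hc h (h' S) hy).elim
    · exact h'
    · exact (hN.cut_not_reachable hc (hbt.up S) hy).elim

/-- A correct net without binary links has exactly one link. -/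
theorem ax_unique_of_no_bin (hN : N.WF) (hc : N.Correct) (hb : ∀ c i j k, ¬ N.bin c i j k) {i j : ℕ}
    (h : N.ax i j) (huniq : ∀ {i' j'}, N.ax i' j' → (i' = i ∨ i' = j ∨ j' = i ∨ j' = j) →
      i' = i ∧ j' = j) {i' j' : ℕ} (h' : N.ax i' j') : i' = i ∧ j' = j := by
  refine huniq h' ?_
  have hr := (hc fun _ => false).reachable (hN.ax_mem h).1 (hN.ax_mem h').1
  have : i' = i ∨ i' = j := hr.closure (P := fun x => x = i ∨ x = j) (.inl rfl)
    fun p q _ hp hpq => by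
      have hup : ∀ {p q}, ¬ N.Up (fun _ => false) p q := by
        rintro p q ⟨c, w, h | h⟩
        · exact hb _ _ _ _ h.1
        · exact hb _ _ _ _ h.1
      rcases hN.graph_adj.1 hpq with h1 | h1 | h1 | h1
      · obtain ⟨rfl, rfl⟩ := huniq h1 (by tauto)
        exact .inr rfl
      · obtain ⟨rfl, rfl⟩ := huniq h1 (by tauto)
        exact .inl rfl
      · exact (hup h1).elim
      · exact (hup h1).elim
  tauto

end WF

theorem correct_of_ax {i j : ℕ} (hij : i ≠ j) (hv : N.verts = {i, j})
    (ha : ∀ u v, N.ax u v ↔ u = i ∧ v = j) (hb : ∀ c x y k, ¬ N.bin c x y k) : N.Correct := by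
  intro S
  have h := (SimpleGraph.isTreeOn_singleton i).add_leaf (y := j) (Set.mem_singleton i)
    (fun h => hij h.symm)
  convert! h using 1
  · ext u v
    have hup : ∀ {p q}, ¬ N.Up S p q := by
      rintro p q ⟨c, w, h | h⟩
      · exact hb _ _ _ _ h.1
      · exact hb _ _ _ _ h.1
    simp only [graph, SimpleGraph.fromRel_adj, ha, hup, SimpleGraph.sup_adj, SimpleGraph.edge_adj,
      SimpleGraph.bot_adj, or_false, false_or]
    tauto
  · rw [hv]
    simp [Set.pair_comm]

/-- Adding a `⅋`-link preserves correctness. -/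
theorem Correct.add_par (h₁ : N₁.Correct) {i j k : ℕ} (hi : i ∈ N₁.verts) (hj : j ∈ N₁.verts)
    (hk : k ∉ N₁.verts) (hv : N.verts = insert k N₁.verts) (ha : ∀ u v, N.ax u v ↔ N₁.ax u v)
    (hb : ∀ c x y z, N.bin c x y z ↔ N₁.bin c x y z ∨ (c = .par ∧ x = i ∧ y = j ∧ z = k)) :
    N.Correct := by
  intro S
  have hik : i ≠ k := by rintro rfl; exact hk hi
  have hjk : j ≠ k := by rintro rfl; exact hk hj
  have hup : ∀ {u v}, N.Up S u v ↔ N₁.Up S u v ∨ u = (if S k then j else i) ∧ v = k := by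
    intro u v
    simp only [Up, hb]
    cases hS : S k <;> grind
  have h := (h₁ S).add_leaf (x := if S k then j else i) (y := k)
    (by split_ifs <;> assumption) hk
  convert! h using 1
  · ext u v
    have : (if S k then j else i) ≠ k := by split_ifs <;> assumption
    simp only [graph, SimpleGraph.fromRel_adj, ha, hup, SimpleGraph.sup_adj, SimpleGraph.edge_adj]
    tauto
  · rw [hv, Finset.coe_insert]

/-- Joining two disjoint correct nets by a `⊗`-link yields a correct net. -/
theorem Correct.add_tens (h₁ : N₁.Correct) (h₂ : N₂.Correct) {i j k : ℕ} (hi : i ∈ N₁.verts)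
    (hj : j ∈ N₂.verts) (hk₁ : k ∉ N₁.verts) (hk₂ : k ∉ N₂.verts)
    (hd : Disjoint N₁.verts N₂.verts) (hv : N.verts = insert k (N₁.verts ∪ N₂.verts))
    (ha : ∀ u v, N.ax u v ↔ N₁.ax u v ∨ N₂.ax u v)
    (hb : ∀ c x y z, N.bin c x y z ↔
      N₁.bin c x y z ∨ N₂.bin c x y z ∨ (c = .tens ∧ x = i ∧ y = j ∧ z = k)) :
    N.Correct := by
  intro S
  have hik : i ≠ k := by rintro rfl; exact hk₁ hi
  have hjk : j ≠ k := by rintro rfl; exact hk₂ hj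
  have hup : ∀ {u v}, N.Up S u v ↔ N₁.Up S u v ∨ N₂.Up S u v ∨ (u = i ∨ u = j) ∧ v = k := by
    intro u v
    simp only [Up, hb]
    grind
  -- The new vertex is hung as a leaf below `i`, and the edge from `k` to `j` then joins the two
  -- trees.
  have h := ((h₁ S).add_leaf (x := i) (y := k) hi hk₁).join (h₂ S)
    (x := k) (y := j) (by
      rw [Set.disjoint_left]
      rintro x (rfl | hx) hx'
      · exact hk₂ hx'
      · exact Finset.disjoint_left.1 hd hx hx') (Set.mem_insert _ _) hj
  convert! h using 1
  · ext u v
    simp only [graph, SimpleGraph.fromRel_adj, ha, hup, SimpleGraph.sup_adj, SimpleGraph.edge_adj]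
    grind
  · rw [hv, Finset.coe_insert, Finset.coe_union, Set.insert_union]

end Net
end MLL

/-! ### The net of a proof structure -/

namespace MLL
namespace Structure

variable {Θ : Structure}

/-- The incidences of a proof structure. -/
def net (Θ : Structure) : Net where
  verts := Θ.forms.image Prod.snd
  ax i j := Link.ax i j ∈ Θ.links
  bin c i j k := ∃ A B, Link.bin c A i B j k ∈ Θ.links

theorem mem_net_verts {x : Occ} (h : x ∈ Θ.forms) : x.2 ∈ Θ.net.verts :=
  Finset.mem_image_of_mem _ h

theorem below_net_iff {u v : ℕ} : Θ.net.Below u v ↔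
    ∃ L ∈ Θ.links, ∃ x ∈ L.premises, ∃ y ∈ L.conclusions, x.2 = u ∧ y.2 = v := by
  constructor
  · rintro ⟨c, w, ⟨A, B, h⟩ | ⟨A, B, h⟩⟩
    · exact ⟨_, h, (A, u), by simp [Link.premises], _, by simp [Link.conclusions]; rfl, rfl, rfl⟩
    · exact ⟨_, h, (B, u), by simp [Link.premises], _, by simp [Link.conclusions]; rfl, rfl, rfl⟩
  · rintro ⟨_ | ⟨c, A, i, B, j, k⟩, hL, x, hx, y, hy, rfl, rfl⟩
    · simp [Link.premises] at hx
    · simp only [Link.premises, Link.conclusions, Finset.mem_insert, Finset.mem_singleton] at hx hy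
      subst hy
      rcases hx with rfl | rfl
      · exact ⟨c, j, .inl ⟨A, B, hL⟩⟩
      · exact ⟨c, i, .inr ⟨A, B, hL⟩⟩

namespace IsProofStructure

/-- Occurrences are determined by their indices, so indices alone identify links. This is what makes
the passage to `net` faithful. -/
theorem link_eq_of_conclusion (h : Θ.IsProofStructure) {L L' : Link} (hL : L ∈ Θ.links)
    (hL' : L' ∈ Θ.links) {x y : Occ} (hx : x ∈ L.conclusions) (hy : y ∈ L'.conclusions)
    (hxy : x.2 = y.2) : L = L' := by
  have hxf := h.conclusions_subset L hL hx
  obtain rfl := h.index_inj x hxf y (h.conclusions_subset L' hL' hy) hxy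
  exact (h.conclusion_unique x hxf).unique ⟨hL, hx⟩ ⟨hL', hy⟩

theorem link_eq_of_premise (h : Θ.IsProofStructure) {L L' : Link} (hL : L ∈ Θ.links)
    (hL' : L' ∈ Θ.links) {x y : Occ} (hx : x ∈ L.premises) (hy : y ∈ L'.premises)
    (hxy : x.2 = y.2) : L = L' := by
  have hxf := h.premises_subset L hL hx
  obtain rfl := h.index_inj x hxf y (h.premises_subset L' hL' hy) hxy
  exact h.premise_unique x hxf L hL L' hL' hx hy

theorem bin_mem_forms (h : Θ.IsProofStructure) {c : Conn} {A B : Formula} {i j k : ℕ}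
    (hL : Link.bin c A i B j k ∈ Θ.links) :
    (A, i) ∈ Θ.forms ∧ (B, j) ∈ Θ.forms ∧ (Formula.bin c A B, k) ∈ Θ.forms :=
  ⟨h.premises_subset _ hL (by simp [Link.premises]),
    h.premises_subset _ hL (by simp [Link.premises]),
    h.conclusions_subset _ hL (by simp [Link.conclusions])⟩

theorem ax_mem_forms (h : Θ.IsProofStructure) {i j : ℕ} (hL : Link.ax i j ∈ Θ.links) :
    (Formula.pos, i) ∈ Θ.forms ∧ (Formula.neg, j) ∈ Θ.forms :=
  ⟨h.conclusions_subset _ hL (by simp [Link.conclusions]),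
    h.conclusions_subset _ hL (by simp [Link.conclusions])⟩

theorem net_wf (h : Θ.IsProofStructure) : Θ.net.WF where
  ax_mem hL := ⟨mem_net_verts (h.ax_mem_forms hL).1, mem_net_verts (h.ax_mem_forms hL).2⟩
  bin_mem := by
    rintro c i j k ⟨A, B, hL⟩
    have := h.bin_mem_forms hL
    exact ⟨mem_net_verts this.1, mem_net_verts this.2.1, mem_net_verts this.2.2⟩
  ax_ne := by
    rintro i j hL rfl
    exact nomatch h.index_inj _ (h.ax_mem_forms hL).1 _ (h.ax_mem_forms hL).2 rfl
  premise_ne := by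
    rintro c i j k ⟨A, B, hL⟩ rfl
    have := h.bin_mem_forms hL
    exact h.premises_ne _ _ _ _ _ _ hL (h.index_inj _ this.1 _ this.2.1 rfl)
  rank := by
    -- The rank is the size of the formula at index `n`. The supremum ranges over a single
    -- occurrence when `n` is the index of one, and is `0` otherwise.
    refine ⟨fun n => (Θ.forms.filter fun x => x.2 = n).sup fun x => sizeOf x.1, ?_⟩
    have key : ∀ x ∈ Θ.forms,
        ((Θ.forms.filter fun y => y.2 = x.2).sup fun x => sizeOf x.1) = sizeOf x.1 := by
      intro x hx
      have : (Θ.forms.filter fun y => y.2 = x.2) = {x} := by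
        ext y
        simp only [Finset.mem_filter, Finset.mem_singleton]
        exact ⟨fun hy => h.index_inj _ hy.1 _ hx hy.2, by rintro rfl; exact ⟨hx, rfl⟩⟩
      rw [this, Finset.sup_singleton]
    rintro u v ⟨c, w, ⟨A, B, hL⟩ | ⟨A, B, hL⟩⟩
    · have hm := h.bin_mem_forms hL
      have h1 := key _ hm.1
      have h2 := key _ hm.2.2
      dsimp only at h1 h2 ⊢
      rw [h1, h2, Formula.bin.sizeOf_spec]
      omega
    · have hm := h.bin_mem_forms hL
      have h1 := key _ hm.2.1
      have h2 := key _ hm.2.2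
      dsimp only at h1 h2 ⊢
      rw [h1, h2, Formula.bin.sizeOf_spec]
      omega
  below_unique := by
    intro u v v' h1 h2
    obtain ⟨L, hL, x, hx, y, hy, rfl, rfl⟩ := below_net_iff.1 h1
    obtain ⟨L', hL', x', hx', y', hy', hxx, rfl⟩ := below_net_iff.1 h2
    obtain rfl := h.link_eq_of_premise hL hL' hx hx' hxx.symm
    rcases L with _ | ⟨c, A, i, B, j, k⟩
    · simp [Link.premises] at hx
    · simp only [Link.conclusions, Finset.mem_singleton] at hy hy'
      rw [hy, hy']
  bin_unique := by
    rintro c i j k c' i' j' ⟨A, B, hL⟩ ⟨A', B', hL'⟩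
    have := h.link_eq_of_conclusion hL hL' (x := (.bin c A B, k)) (y := (.bin c' A' B', k))
      (by simp [Link.conclusions]) (by simp [Link.conclusions]) rfl
    cases this
    exact ⟨rfl, rfl, rfl⟩
  ax_not_bin := by
    rintro i j hL c x y
    constructor
    · rintro ⟨A, B, hL'⟩
      exact nomatch h.link_eq_of_conclusion hL hL' (x := (.pos, i)) (y := (.bin c A B, i))
        (by simp [Link.conclusions]) (by simp [Link.conclusions]) rfl
    · rintro ⟨A, B, hL'⟩
      exact nomatch h.link_eq_of_conclusion hL hL' (x := (.neg, j)) (y := (.bin c A B, j))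
        (by simp [Link.conclusions]) (by simp [Link.conclusions]) rfl
  cover := by
    intro n hn
    obtain ⟨x, hx, rfl⟩ := Finset.mem_image.1 hn
    obtain ⟨_ | ⟨c, A, i, B, j, k⟩, ⟨hL, hxL⟩, -⟩ := h.conclusion_unique x hx
    · simp only [Link.conclusions, Finset.mem_insert, Finset.mem_singleton] at hxL
      rcases hxL with rfl | rfl
      · exact .inl ⟨_, .inl hL⟩
      · exact .inl ⟨_, .inr hL⟩
    · simp only [Link.conclusions, Finset.mem_singleton] at hxL
      subst hxL
      exact .inr ⟨_, _, _, _, _, hL⟩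

theorem isConclusion_iff (h : Θ.IsProofStructure) {x : Occ} (hx : x ∈ Θ.forms) :
    Θ.IsConclusion x ↔ Θ.net.Final x.2 := by
  constructor
  · rintro ⟨-, hc⟩
    refine ⟨mem_net_verts hx, fun v hv => ?_⟩
    obtain ⟨L, hL, y, hy, -, -, hyx, -⟩ := below_net_iff.1 hv
    obtain rfl := h.index_inj _ (h.premises_subset _ hL hy) _ hx hyx
    exact hc _ hL hy
  · rintro ⟨-, hc⟩
    refine ⟨hx, fun L hL hxL => ?_⟩
    rcases L with _ | ⟨c, A, i, B, j, k⟩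
    · simp [Link.premises] at hxL
    · exact hc k (below_net_iff.2 ⟨_, hL, x, hxL, _, by simp [Link.conclusions]; rfl, rfl, rfl⟩)

end IsProofStructure

/-- The nets of sequentializable structures satisfy the Danos-Regnier criterion. -/
theorem Sequentializable.net_correct (h : Θ.Sequentializable) : Θ.net.Correct := by
  induction h with
  | ax Θ i j hΘ hL =>
    have hmem := hΘ.ax_mem_forms (i := i) (j := j) (by simp [hL])
    refine Net.correct_of_ax (i := i) (j := j) (hΘ.net_wf.ax_ne (by simp [net, hL])) ?_
      (by simp [net, hL]) (by simp [net, hL])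
    have : Θ.forms = {(.pos, i), (.neg, j)} := by
      refine subset_antisymm (fun x hx => ?_) ?_
      · obtain ⟨L, ⟨hL', hx⟩, -⟩ := hΘ.conclusion_unique x hx
        rw [hL, Finset.mem_singleton] at hL'
        subst hL'
        exact hx
      · simp [Finset.insert_subset_iff, hmem]
    simp [net, this]
  | par Θ A B i j k hΘ hL hconc _ ih =>
    have hmem := hΘ.bin_mem_forms hL
    refine ih.add_par (i := i) (j := j) (k := k) ?_ ?_ ?_ ?_ ?_ ?_
    · refine Finset.mem_image.2 ⟨(A, i), Finset.mem_erase.2 ⟨fun h => ?_, hmem.1⟩, rfl⟩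
      exact hΘ.net_wf.below_ne ⟨_, _, .inl ⟨A, B, hL⟩⟩ (congrArg Prod.snd h)
    · refine Finset.mem_image.2 ⟨(B, j), Finset.mem_erase.2 ⟨fun h => ?_, hmem.2.1⟩, rfl⟩
      exact hΘ.net_wf.below_ne ⟨_, _, .inr ⟨A, B, hL⟩⟩ (congrArg Prod.snd h)
    · intro hk
      obtain ⟨x, hx, hxk⟩ := Finset.mem_image.1 hk
      rw [Finset.mem_erase] at hx
      exact hx.1 (hΘ.index_inj _ hx.2 _ hmem.2.2 hxk)
    · simp only [net]
      conv_lhs => rw [← Finset.insert_erase hmem.2.2]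
      rw [Finset.image_insert]
    · simp [net]
    · intro c x y z
      simp only [net, Finset.mem_erase]
      constructor
      · rintro ⟨X, Y, h⟩
        by_cases he : Link.bin c X x Y y z = Link.bin .par A i B j k
        · cases he
          simp
        · exact .inl ⟨X, Y, he, h⟩
      · rintro (⟨X, Y, -, h⟩ | ⟨rfl, rfl, rfl, rfl⟩)
        · exact ⟨X, Y, h⟩
        · exact ⟨A, B, hL⟩
  | tens Θ Θ₁ Θ₂ A B i j k hΘ hL hconc hforms hfd hfn hlinks _ _ hA hB _ _ _ _ ih₁ ih₂ =>
    have hmem := hΘ.bin_mem_forms hL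
    have hsub₁ : Θ₁.forms ⊆ Θ.forms := by
      rw [hforms]
      exact Finset.subset_union_left.trans (Finset.subset_insert _ _)
    have hsub₂ : Θ₂.forms ⊆ Θ.forms := by
      rw [hforms]
      exact Finset.subset_union_right.trans (Finset.subset_insert _ _)
    rw [Finset.mem_union, not_or] at hfn
    refine ih₁.add_tens ih₂ (i := i) (j := j) (k := k) (mem_net_verts hA) (mem_net_verts hB)
      ?_ ?_ ?_ ?_ ?_ ?_
    · intro hk
      obtain ⟨x, hx, hxk⟩ := Finset.mem_image.1 hk
      exact hfn.1 (hΘ.index_inj _ (hsub₁ hx) _ hmem.2.2 hxk ▸ hx)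
    · intro hk
      obtain ⟨x, hx, hxk⟩ := Finset.mem_image.1 hk
      exact hfn.2 (hΘ.index_inj _ (hsub₂ hx) _ hmem.2.2 hxk ▸ hx)
    · rw [Finset.disjoint_left]
      intro n hn hn'
      obtain ⟨x, hx, rfl⟩ := Finset.mem_image.1 hn
      obtain ⟨y, hy, hxy⟩ := Finset.mem_image.1 hn'
      exact Finset.disjoint_left.1 hfd hx (hΘ.index_inj _ (hsub₂ hy) _ (hsub₁ hx) hxy ▸ hy)
    · simp only [net, hforms]
      rw [Finset.image_insert, Finset.image_union]
    · simp [net, hlinks]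
    · intro c x y z
      simp only [net, hlinks, Finset.mem_insert, Finset.mem_union]
      constructor
      · rintro ⟨X, Y, h | h | h⟩
        · cases h
          simp
        · exact .inl ⟨X, Y, h⟩
        · exact .inr (.inl ⟨X, Y, h⟩)
      · rintro (⟨X, Y, h⟩ | ⟨X, Y, h⟩ | ⟨rfl, rfl, rfl, rfl⟩)
        · exact ⟨X, Y, .inr (.inl h)⟩
        · exact ⟨X, Y, .inr (.inr h)⟩
        · exact ⟨A, B, .inl rfl⟩

end Structure
end MLL

/-! ### Restriction of proof structures and sequentialization -/

namespace MLL
namespace Structure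

variable {Θ : Structure} {U : Set ℕ}

open Classical in
/-- The part of a proof structure over a set of indices. -/
noncomputable def restrict (Θ : Structure) (U : Set ℕ) : Structure where
  forms := Θ.forms.filter fun x => x.2 ∈ U
  links := Θ.links.filter fun L => ∀ x ∈ L.conclusions, x.2 ∈ U

theorem mem_restrict_forms {x : Occ} : x ∈ (Θ.restrict U).forms ↔ x ∈ Θ.forms ∧ x.2 ∈ U := by
  simp [restrict]

theorem mem_restrict_links {L : Link} :
    L ∈ (Θ.restrict U).links ↔ L ∈ Θ.links ∧ ∀ x ∈ L.conclusions, x.2 ∈ U := by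
  simp [restrict]

theorem ax_mem_restrict_links {i j : ℕ} :
    Link.ax i j ∈ (Θ.restrict U).links ↔ Link.ax i j ∈ Θ.links ∧ i ∈ U ∧ j ∈ U := by
  simp [mem_restrict_links, Link.conclusions]

theorem bin_mem_restrict_links {c : Conn} {A B : Formula} {i j k : ℕ} :
    Link.bin c A i B j k ∈ (Θ.restrict U).links ↔ Link.bin c A i B j k ∈ Θ.links ∧ k ∈ U := by
  simp [mem_restrict_links, Link.conclusions]

theorem net_restrict : (Θ.restrict U).net = Θ.net.restrict U := by
  simp only [net, Net.restrict, ax_mem_restrict_links, bin_mem_restrict_links, Net.mk.injEq,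
    exists_and_right, and_true]
  ext n
  simp only [Finset.mem_image, mem_restrict_forms, Finset.mem_filter]
  constructor
  · rintro ⟨x, hx, rfl⟩
    exact ⟨⟨x, hx.1, rfl⟩, hx.2⟩
  · rintro ⟨⟨x, hx, rfl⟩, hU⟩
    exact ⟨x, ⟨hx, hU⟩, rfl⟩

/-- Upward closure is what is needed: it keeps the premises of every remaining link, and it keeps an
ID-link whole as soon as one of its conclusions remains. -/
theorem IsProofStructure.restrict (h : Θ.IsProofStructure) (hU : Θ.net.UpClosed U) :
    (Θ.restrict U).IsProofStructure where
  premises_subset L hL x hx := by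
    rw [mem_restrict_links] at hL
    rw [mem_restrict_forms]
    refine ⟨h.premises_subset L hL.1 hx, ?_⟩
    rcases L with _ | ⟨c, A, i, B, j, k⟩
    · simp [Link.premises] at hx
    · have hk : (Formula.bin c A B, k) ∈ (Link.bin c A i B j k).conclusions := by
        simp [Link.conclusions]
      exact hU.2 (below_net_iff.2 ⟨_, hL.1, x, hx, _, hk, rfl, rfl⟩) (hL.2 _ hk)
  conclusions_subset L hL x hx := by
    rw [mem_restrict_links] at hL
    exact mem_restrict_forms.2 ⟨h.conclusions_subset L hL.1 hx, hL.2 x hx⟩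
  index_inj x hx y hy :=
    h.index_inj x (mem_restrict_forms.1 hx).1 y (mem_restrict_forms.1 hy).1
  premise_unique x hx L hL L' hL' :=
    h.premise_unique x (mem_restrict_forms.1 hx).1 L (mem_restrict_links.1 hL).1 L'
      (mem_restrict_links.1 hL').1
  premises_ne c A i B j k hL := h.premises_ne c A i B j k (mem_restrict_links.1 hL).1
  conclusion_unique x hx := by
    rw [mem_restrict_forms] at hx
    obtain ⟨L, ⟨hL, hxL⟩, huniq⟩ := h.conclusion_unique x hx.1
    refine ⟨L, ⟨mem_restrict_links.2 ⟨hL, fun y hy => ?_⟩, hxL⟩,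
      fun L' hL' => huniq L' ⟨(mem_restrict_links.1 hL'.1).1, hL'.2⟩⟩
    rcases L with ⟨i, j⟩ | ⟨c, A, i, B, j, k⟩
    · have := hU.1 (u := i) (v := j) hL
      simp only [Link.conclusions, Finset.mem_insert, Finset.mem_singleton] at hxL hy
      rcases hxL with rfl | rfl <;> rcases hy with rfl | rfl <;> simp_all
    · simp only [Link.conclusions, Finset.mem_singleton] at hxL hy
      rw [hy, ← hxL]
      exact hx.2

/-- The structure in the ⅋-case of `Sequentializable` becomes a restriction, to which the results on
restricted nets apply. -/
theorem IsProofStructure.erase_eq_restrict (h : Θ.IsProofStructure) {c : Conn} {A B : Formula}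
    {i j k : ℕ} (hL : Link.bin c A i B j k ∈ Θ.links) :
    (⟨Θ.forms.erase (.bin c A B, k), Θ.links.erase (.bin c A i B j k)⟩ : Structure) =
      Θ.restrict {k}ᶜ := by
  have hmem := (h.bin_mem_forms hL).2.2
  simp only [Structure.restrict, Structure.mk.injEq]
  constructor
  · ext x
    simp only [Finset.mem_erase, Finset.mem_filter, Set.mem_compl_iff, Set.mem_singleton_iff]
    constructor
    · rintro ⟨hx, hxf⟩
      exact ⟨hxf, fun hk => hx (h.index_inj _ hxf _ hmem hk)⟩
    · rintro ⟨hxf, hk⟩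
      refine ⟨?_, hxf⟩
      rintro rfl
      exact hk rfl
  · ext L
    simp only [Finset.mem_erase, Finset.mem_filter, Set.mem_compl_iff, Set.mem_singleton_iff]
    constructor
    · rintro ⟨hne, hL'⟩
      exact ⟨hL', fun x hx hk => hne (h.link_eq_of_conclusion hL' hL hx
        (y := (.bin c A B, k)) (by simp [Link.conclusions]) hk)⟩
    · rintro ⟨hL', hk⟩
      refine ⟨?_, hL'⟩
      rintro rfl
      exact hk (.bin c A B, k) (by simp [Link.conclusions]) rfl

/-- The sequentialization theorem: a proof structure that satisfies the Danos-Regnier criterion is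
sequentializable. -/
theorem IsProofStructure.sequentializable (h : Θ.IsProofStructure) (hne : Θ.forms.Nonempty)
    (hc : Θ.net.Correct) : Θ.Sequentializable := by
  induction hn : Θ.links.card using Nat.strong_induction_on generalizing Θ with
  | _ n ih =>
  subst hn
  have hN := h.net_wf
  have hlt : ∀ {V : Set ℕ} {c A i B j k}, Link.bin c A i B j k ∈ Θ.links → k ∉ V →
      (Θ.restrict V).links.card < Θ.links.card := fun hL hk =>
    Finset.card_lt_card ⟨fun L hL' => (mem_restrict_links.1 hL').1,
      fun hsub => hk (bin_mem_restrict_links.1 (hsub hL)).2⟩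
  by_cases hpar : ∃ i j k, Θ.net.bin .par i j k ∧ Θ.net.Final k
  · obtain ⟨i, j, k, hb, hf⟩ := hpar
    have ⟨hU, hc'⟩ := hN.correct_remove_par hc hb hf
    have hik : i ≠ k := hN.below_ne ⟨_, _, .inl hb⟩
    obtain ⟨A, B, hL⟩ := hb
    have hmem := h.bin_mem_forms hL
    refine .par Θ A B i j k h hL ((h.isConclusion_iff hmem.2.2).2 hf) ?_
    rw [h.erase_eq_restrict hL]
    exact ih _ (hlt hL (by simp)) (h.restrict hU)
      ⟨(A, i), mem_restrict_forms.2 ⟨hmem.1, hik⟩⟩ (net_restrict ▸ hc') rfl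
  push Not at hpar
  by_cases hbin : ∃ c i j k, Θ.net.bin c i j k
  · obtain ⟨c, i, j, k, hb⟩ := hbin
    obtain ⟨a, b, t, hab, hf, hs⟩ := hN.exists_splitting hc hpar hb
    have hca := (hN.correct_restrict_empire hc hab hs).1
    have hcb := (hN.correct_restrict_empire hc hab hs).2
    have hta := hN.not_mem_empire_of_below hc (v := t) ⟨_, _, .inl hab⟩
    have htb := hN.not_mem_empire_of_below hc (v := t) ⟨_, _, .inr hab⟩
    have hd := Set.disjoint_left.1 (hN.empire_disjoint hc hab)
    have hUa := hN.upClosed_empire hc a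
    have hUb := hN.upClosed_empire hc b
    obtain ⟨A, B, hL⟩ := hab
    have hmem := h.bin_mem_forms hL
    have hcases : ∀ {n}, n ∈ Θ.net.verts → n = t ∨ n ∈ Θ.net.empire a ∨ n ∈ Θ.net.empire b :=
      fun {n} hn => by
        have : n ∈ (Θ.net.verts : Set ℕ) := hn
        rw [hs] at this
        rcases this with h | h
        · exact .inr h
        · exact .inl h
    have hA : (A, a) ∈ (Θ.restrict (Θ.net.empire a)).forms :=
      mem_restrict_forms.2 ⟨hmem.1, Net.mem_empire_self _ _⟩
    have hB : (B, b) ∈ (Θ.restrict (Θ.net.empire b)).forms :=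
      mem_restrict_forms.2 ⟨hmem.2.1, Net.mem_empire_self _ _⟩
    refine .tens Θ (Θ.restrict (Θ.net.empire a)) (Θ.restrict (Θ.net.empire b)) A B a b t h hL
      ((h.isConclusion_iff hmem.2.2).2 hf) ?_ ?_ ?_ ?_ ?_ ?_ hA hB (h.restrict hUa) (h.restrict hUb)
      (ih _ (hlt hL hta) (h.restrict hUa) ⟨_, hA⟩ (net_restrict ▸ hca) rfl)
      (ih _ (hlt hL htb) (h.restrict hUb) ⟨_, hB⟩ (net_restrict ▸ hcb) rfl)
    · ext x
      simp only [Finset.mem_insert, Finset.mem_union, mem_restrict_forms]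
      constructor
      · intro hx
        rcases hcases (mem_net_verts hx) with hx' | hx' | hx'
        · exact .inl (h.index_inj _ hx _ hmem.2.2 hx')
        · exact .inr (.inl ⟨hx, hx'⟩)
        · exact .inr (.inr ⟨hx, hx'⟩)
      · rintro (rfl | hx | hx)
        · exact hmem.2.2
        · exact hx.1
        · exact hx.1
    · refine Finset.disjoint_left.2 fun x hx hx' => ?_
      exact hd (mem_restrict_forms.1 hx).2 (mem_restrict_forms.1 hx').2
    · simp [mem_restrict_forms, hta, htb]
    · ext L
      simp only [Finset.mem_insert, Finset.mem_union]
      constructor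
      · intro hL'
        rcases L with ⟨i, j⟩ | ⟨c, X, i, Y, j, k⟩
        · simp only [ax_mem_restrict_links]
          have h1 := hUa.1 (u := i) (v := j) hL'
          have h2 := hUb.1 (u := i) (v := j) hL'
          rcases hcases (mem_net_verts (h.ax_mem_forms hL').1) with hx' | hx' | hx'
          · cases hx'
            exact ((hN.ax_not_bin hL' _ _ _).1 ⟨_, _, hL⟩).elim
          · exact .inr (.inl ⟨hL', hx', h1.1 hx'⟩)
          · exact .inr (.inr ⟨hL', hx', h2.1 hx'⟩)
        · simp only [bin_mem_restrict_links]
          rcases hcases (mem_net_verts (h.bin_mem_forms hL').2.2) with hx' | hx' | hx'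
          · exact .inl (h.link_eq_of_conclusion hL' hL (x := (.bin c X Y, k))
              (y := (.bin .tens A B, t)) (by simp [Link.conclusions]) (by simp [Link.conclusions])
              hx')
          · exact .inr (.inl ⟨hL', hx'⟩)
          · exact .inr (.inr ⟨hL', hx'⟩)
      · rintro (rfl | hL' | hL')
        · exact hL
        · exact (mem_restrict_links.1 hL').1
        · exact (mem_restrict_links.1 hL').1
    · refine Finset.disjoint_left.2 fun L hL₁ hL₂ => ?_
      rcases L with ⟨i, j⟩ | ⟨c, X, i, Y, j, k⟩
      · exact hd (ax_mem_restrict_links.1 hL₁).2.1 (ax_mem_restrict_links.1 hL₂).2.1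
      · exact hd (bin_mem_restrict_links.1 hL₁).2 (bin_mem_restrict_links.1 hL₂).2
    · simp [bin_mem_restrict_links, hta, htb]
  · push Not at hbin
    -- The empty structure satisfies the criterion vacuously, so nonemptiness is needed to obtain a
    -- link. With no binary links, connectedness allows only this one.
    obtain ⟨x, hx⟩ := hne
    obtain ⟨L, ⟨hL, -⟩, -⟩ := h.conclusion_unique x hx
    rcases L with ⟨i, j⟩ | ⟨c, X, i, Y, j, k⟩
    · refine .ax Θ i j h (Finset.eq_singleton_iff_unique_mem.2 ⟨hL, fun L' hL' => ?_⟩)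
      rcases L' with ⟨i', j'⟩ | ⟨c, X, i', Y, j', k⟩
      · have huniq : ∀ {i' j'}, Θ.net.ax i' j' → (i' = i ∨ i' = j ∨ j' = i ∨ j' = j) →
            i' = i ∧ j' = j := by
          intro i' j' h1 h2
          have : ∃ x ∈ (Link.ax i' j').conclusions, ∃ y ∈ (Link.ax i j).conclusions, x.2 = y.2 := by
            simpa [Link.conclusions, or_assoc] using h2
          obtain ⟨x, hx, y, hy, hxy⟩ := this
          cases h.link_eq_of_conclusion h1 hL hx hy hxy
          exact ⟨rfl, rfl⟩
        obtain ⟨rfl, rfl⟩ := hN.ax_unique_of_no_bin hc hbin hL huniq hL'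
        rfl
      · exact (hbin _ _ _ _ ⟨_, _, hL'⟩).elim
    · exact (hbin _ _ _ _ ⟨_, _, hL⟩).elim

end Structure
end MLL

namespace MLL

theorem Conn.flip_flip (c : Conn) : c.flip.flip = c := by cases c <;> rfl

namespace Structure

variable {Θ : Structure} {X : Finset Link} {c : Conn} {A B : Formula} {i j k : ℕ}

/-! ### Exchanging connectives -/

/-- The link picked by choice in `flipFormula` has the same conclusion as the given one, and only
one link has it. -/
theorem IsProofStructure.flipFormula_bin (h : Θ.IsProofStructure)
    (hL : Link.bin c A i B j k ∈ Θ.links) : Θ.flipFormula X (.bin c A B) k =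
      .bin (if Link.bin c A i B j k ∈ X then c.flip else c) (Θ.flipFormula X A i)
        (Θ.flipFormula X B j) := by
  have hex : ∃ r : ℕ × ℕ, Link.bin c A r.1 B r.2 k ∈ Θ.links := ⟨(i, j), hL⟩
  have heq : hex.choose = (i, j) := by
    have := h.link_eq_of_conclusion hex.choose_spec hL (x := (.bin c A B, k))
      (y := (.bin c A B, k)) (by simp [Link.conclusions]) (by simp [Link.conclusions]) rfl
    injection this with _ _ h1 _ h2
    exact Prod.ext h1 h2
  rw [flipFormula, dif_pos hex, heq]

theorem flipLink_premises (L : Link) :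
    (Θ.flipLink X L).premises = L.premises.image (Θ.flipOcc X) := by
  rcases L with _ | _ <;> simp [flipLink, Link.premises, flipOcc]

theorem IsProofStructure.flipLink_conclusions (h : Θ.IsProofStructure) {L : Link}
    (hL : L ∈ Θ.links) : (Θ.flipLink X L).conclusions = L.conclusions.image (Θ.flipOcc X) := by
  rcases L with _ | _
  · simp [flipLink, Link.conclusions, flipOcc, flipFormula]
  · simp [flipLink, Link.conclusions, flipOcc, h.flipFormula_bin hL]

/-- `flipOcc` preserves indices, and these determine occurrences and links, so every incidence of
the new structure comes from one of `Θ`. -/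
theorem IsProofStructure.exchange (h : Θ.IsProofStructure) (L₁ L₂ : Link) :
    (Θ.exchange L₁ L₂).IsProofStructure where
  premises_subset L' hL' := by
    obtain ⟨L, hL, rfl⟩ := Finset.mem_image.1 hL'
    rw [flipLink_premises]
    exact Finset.image_subset_image (h.premises_subset L hL)
  conclusions_subset L' hL' := by
    obtain ⟨L, hL, rfl⟩ := Finset.mem_image.1 hL'
    rw [h.flipLink_conclusions hL]
    exact Finset.image_subset_image (h.conclusions_subset L hL)
  index_inj x' hx' y' hy' hxy := by
    obtain ⟨x, hx, rfl⟩ := Finset.mem_image.1 hx'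
    obtain ⟨y, hy, rfl⟩ := Finset.mem_image.1 hy'
    rw [h.index_inj x hx y hy hxy]
  premise_unique x' _ L' hL' M' hM' hxL hxM := by
    obtain ⟨L, hL, rfl⟩ := Finset.mem_image.1 hL'
    obtain ⟨M, hM, rfl⟩ := Finset.mem_image.1 hM'
    rw [flipLink_premises, Finset.mem_image] at hxL hxM
    obtain ⟨x, hx, rfl⟩ := hxL
    obtain ⟨y, hy, hxy⟩ := hxM
    rw [h.link_eq_of_premise hL hM hx hy (congrArg Prod.snd hxy).symm]
  premises_ne c A i B j k hL' hij := by
    obtain ⟨_ | ⟨c', A', i', B', j', k'⟩, hL, heq⟩ := Finset.mem_image.1 hL'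
    · exact nomatch heq
    · rw [flipLink] at heq
      injection heq with _ _ h1 _ h2
      refine h.net_wf.premise_ne ⟨A', B', hL⟩ ?_
      rw [h1, h2]
      exact congrArg Prod.snd hij
  conclusion_unique x' hx' := by
    obtain ⟨x, hx, rfl⟩ := Finset.mem_image.1 hx'
    obtain ⟨L, ⟨hL, hxL⟩, -⟩ := h.conclusion_unique x hx
    refine ⟨Θ.flipLink _ L, ⟨Finset.mem_image_of_mem _ hL, ?_⟩, ?_⟩
    · rw [h.flipLink_conclusions hL]
      exact Finset.mem_image_of_mem _ hxL
    · rintro M' ⟨hM', hxM⟩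
      obtain ⟨M, hM, rfl⟩ := Finset.mem_image.1 hM'
      rw [h.flipLink_conclusions hM, Finset.mem_image] at hxM
      obtain ⟨y, hy, hxy⟩ := hxM
      have hxy : y.2 = x.2 := (congrArg Prod.snd hxy.symm).symm
      rw [h.link_eq_of_conclusion hM hL hy hxL hxy]

/-- Membership in the exchanged pair is decided by the index of the conclusion, which is the test in
`Net.flip`. That definition reads the old connective off the new one, in the direction opposite to
`flipLink`; duality being an involution, both agree. -/
theorem IsProofStructure.net_exchange (h : Θ.IsProofStructure) {c₁ c₂ : Conn}
    {A B C D : Formula} {a b t c d q : ℕ} (h₁ : Link.bin c₁ A a B b t ∈ Θ.links)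
    (h₂ : Link.bin c₂ C c D d q ∈ Θ.links) :
    (Θ.exchange (.bin c₁ A a B b t) (.bin c₂ C c D d q)).net = Θ.net.flip t q := by
  have hmem : ∀ {e E i F j k}, Link.bin e E i F j k ∈ Θ.links →
      (Link.bin e E i F j k ∈ ({.bin c₁ A a B b t, .bin c₂ C c D d q} : Finset Link) ↔
        k = t ∨ k = q) := by
    intro e E i F j k hL
    rw [Finset.mem_insert, Finset.mem_singleton]
    refine or_congr ⟨fun he => ?_, fun he => ?_⟩ ⟨fun he => ?_, fun he => ?_⟩
    · injection he
    · exact h.link_eq_of_conclusion hL h₁ (x := (.bin e E F, k)) (y := (.bin c₁ A B, t))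
        (by simp [Link.conclusions]) (by simp [Link.conclusions]) he
    · injection he
    · exact h.link_eq_of_conclusion hL h₂ (x := (.bin e E F, k)) (y := (.bin c₂ C D, q))
        (by simp [Link.conclusions]) (by simp [Link.conclusions]) he
  simp only [net, Net.flip, Net.mk.injEq]
  refine ⟨?_, ?_, ?_⟩
  · rw [Structure.exchange, Finset.image_image]
    rfl
  · funext i j
    refine propext ⟨fun hL => ?_, fun hL => Finset.mem_image.2 ⟨_, hL, rfl⟩⟩
    obtain ⟨_ | _, hL, heq⟩ := Finset.mem_image.1 hL
    · rw [flipLink] at heq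
      exact heq ▸ hL
    · exact nomatch heq
  · funext e i j k
    refine propext ⟨?_, ?_⟩
    · rintro ⟨E, F, hL'⟩
      obtain ⟨_ | ⟨e', E', i', F', j', k'⟩, hL, heq⟩ := Finset.mem_image.1 hL'
      · exact nomatch heq
      · rw [flipLink] at heq
        injection heq with h1 _ h3 _ h5 h6
        subst i' j' k'
        clear hL'
        refine ⟨E', F', ?_⟩
        rw [← h1]
        simp only [hmem hL]
        split_ifs
        · rwa [Conn.flip_flip]
        · exact hL
    · rintro ⟨E, F, hL⟩
      let X : Finset Link := {.bin c₁ A a B b t, .bin c₂ C c D d q}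
      refine ⟨Θ.flipFormula X E i, Θ.flipFormula X F j, Finset.mem_image.2 ⟨_, hL, ?_⟩⟩
      rw [flipLink]
      simp only [hmem hL]
      congr 1
      split_ifs
      · exact Conn.flip_flip e
      · rfl

/-! ### Empires -/

/-- A switching of the links and a switching of the indices select the same premises. -/
def SameSwitching (Θ : Structure) (S : Switching) (S' : ℕ → Bool) : Prop :=
  ∀ A i B j k, Link.bin .par A i B j k ∈ Θ.links → S (.bin .par A i B j k) = S' k

theorem IsProofStructure.drEdge_iff (h : Θ.IsProofStructure) {S : Switching} {S' : ℕ → Bool}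
    (hS : Θ.SameSwitching S S') {x y : Occ} (hx : x ∈ Θ.forms) (hy : y ∈ Θ.forms) :
    Θ.DREdge S x y ↔ Θ.net.ax x.2 y.2 ∨ Θ.net.Up S' x.2 y.2 := by
  constructor
  · rintro (⟨i, j, hL⟩ | ⟨A, B, i, j, k, hL⟩ | ⟨A, B, i, j, k, hL⟩ | ⟨A, B, i, j, k, hL, hs⟩ |
      ⟨A, B, i, j, k, hL, hs⟩)
    · exact .inl hL
    · exact .inr ⟨_, _, .inl ⟨⟨_, _, hL⟩, nofun⟩⟩
    · exact .inr ⟨_, _, .inr ⟨⟨_, _, hL⟩, nofun⟩⟩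
    · exact .inr ⟨_, _, .inl ⟨⟨_, _, hL⟩, fun _ => hS _ _ _ _ _ hL ▸ hs⟩⟩
    · exact .inr ⟨_, _, .inr ⟨⟨_, _, hL⟩, fun _ => hS _ _ _ _ _ hL ▸ hs⟩⟩
  · rintro (hL | ⟨c, w, ⟨⟨A, B, hL⟩, hs⟩ | ⟨⟨A, B, hL⟩, hs⟩⟩)
    · have hm := h.ax_mem_forms hL
      rw [h.index_inj _ hx _ hm.1 rfl, h.index_inj _ hy _ hm.2 rfl]
      exact .ax _ _ hL
    · have hm := h.bin_mem_forms hL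
      rw [h.index_inj _ hx _ hm.1 rfl, h.index_inj _ hy _ hm.2.2 rfl]
      cases c with
      | tens => exact .tens_left _ _ _ _ _ hL
      | par => exact .par_left _ _ _ _ _ hL ((hS _ _ _ _ _ hL).trans (hs rfl))
    · have hm := h.bin_mem_forms hL
      rw [h.index_inj _ hx _ hm.2.1 rfl, h.index_inj _ hy _ hm.2.2 rfl]
      cases c with
      | tens => exact .tens_right _ _ _ _ _ hL
      | par => exact .par_right _ _ _ _ _ hL ((hS _ _ _ _ _ hL).trans (hs rfl))

theorem IsProofStructure.drEdge_mem (h : Θ.IsProofStructure) {S : Switching} {x y : Occ}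
    (hxy : Θ.DREdge S x y) : x ∈ Θ.forms ∧ y ∈ Θ.forms := by
  rcases hxy with ⟨i, j, hL⟩ | ⟨A, B, i, j, k, hL⟩ | ⟨A, B, i, j, k, hL⟩ |
    ⟨A, B, i, j, k, hL, hs⟩ | ⟨A, B, i, j, k, hL, hs⟩
  · exact h.ax_mem_forms hL
  · exact ⟨(h.bin_mem_forms hL).1, (h.bin_mem_forms hL).2.2⟩
  · exact (h.bin_mem_forms hL).2
  · exact ⟨(h.bin_mem_forms hL).1, (h.bin_mem_forms hL).2.2⟩
  · exact (h.bin_mem_forms hL).2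

theorem IsProofStructure.cutGraph_adj_mem (h : Θ.IsProofStructure) {S : Switching} {a x y : Occ}
    (hxy : (Θ.cutGraph S a).Adj x y) : x ∈ Θ.forms ∧ y ∈ Θ.forms := by
  rw [cutGraph, SimpleGraph.deleteEdges_adj, drGraph, SimpleGraph.fromRel_adj] at hxy
  rcases hxy.1.2 with h' | h'
  · exact h.drEdge_mem h'
  · exact (h.drEdge_mem h').symm

theorem IsProofStructure.cutGraph_adj_iff (h : Θ.IsProofStructure) {S : Switching} {S' : ℕ → Bool}
    (hS : Θ.SameSwitching S S') {a x y : Occ} (ha : a ∈ Θ.forms) (hx : x ∈ Θ.forms)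
    (hy : y ∈ Θ.forms) : (Θ.cutGraph S a).Adj x y ↔ (Θ.net.cut S' a.2).Adj x.2 y.2 := by
  have hinj : ∀ {z w}, z ∈ Θ.forms → w ∈ Θ.forms → (z = w ↔ z.2 = w.2) := fun hz hw =>
    ⟨congrArg _, h.index_inj _ hz _ hw⟩
  rw [cutGraph, Net.cut, SimpleGraph.deleteEdges_adj, SimpleGraph.deleteEdges_adj, drGraph,
    Net.graph, SimpleGraph.fromRel_adj, SimpleGraph.fromRel_adj, h.drEdge_iff hS hx hy,
    h.drEdge_iff hS hy hx, ne_eq, hinj hx hy]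
  refine and_congr_right fun _ => not_congr ?_
  constructor
  · rintro ⟨L, hL, haL, e, he, heq⟩
    refine ⟨e.2, below_net_iff.2 ⟨L, hL, a, haL, e, he, rfl, rfl⟩, ?_⟩
    rw [Sym2.eq_iff] at heq ⊢
    rcases heq with ⟨rfl, rfl⟩ | ⟨rfl, rfl⟩
    · exact .inl ⟨rfl, rfl⟩
    · exact .inr ⟨rfl, rfl⟩
  · rintro ⟨v, hv, heq⟩
    obtain ⟨L, hL, a', haL, e, he, haa, rfl⟩ := below_net_iff.1 hv
    obtain rfl := h.index_inj _ (h.premises_subset _ hL haL) _ ha haa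
    refine ⟨L, hL, haL, e, he, ?_⟩
    have hef := h.conclusions_subset _ hL he
    rw [Sym2.eq_iff] at heq ⊢
    rwa [hinj hx ha, hinj hy hef, hinj hx hef, hinj hy ha]

theorem IsProofStructure.cutGraph_reachable_iff (h : Θ.IsProofStructure) {S : Switching}
    {S' : ℕ → Bool} (hS : Θ.SameSwitching S S') {a x : Occ} (ha : a ∈ Θ.forms) (hx : x ∈ Θ.forms) :
    (Θ.cutGraph S a).Reachable a x ↔ (Θ.net.cut S' a.2).Reachable a.2 x.2 := by
  constructor
  · intro hr
    refine hr.closure (P := fun y => (Θ.net.cut S' a.2).Reachable a.2 y.2) .rfl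
      fun u v _ hu huv => hu.trans ?_
    have hm := h.cutGraph_adj_mem huv
    exact ((h.cutGraph_adj_iff hS ha hm.1 hm.2).1 huv).reachable
  · intro hr
    obtain ⟨y, hy, hyx, hr'⟩ := hr.closure
      (P := fun n => ∃ y ∈ Θ.forms, y.2 = n ∧ (Θ.cutGraph S a).Reachable a y) ⟨a, ha, rfl, .rfl⟩ <| by
        rintro u v - ⟨y, hy, rfl, hr⟩ huv
        obtain ⟨z, hz, rfl⟩ := Finset.mem_image.1
          (h.net_wf.graph_adj_mem (Net.cut_le huv.symm))
        exact ⟨z, hz, rfl, hr.trans ((h.cutGraph_adj_iff hS ha hy hz).2 huv).reachable⟩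
    obtain rfl := h.index_inj _ hy _ hx hyx
    exact hr'

/-- The two definitions quantify over switchings of links and of indices respectively. Every
switching of one kind has a partner of the other kind that selects the same premises, because a
⅋-link is determined by the index of its conclusion. -/
theorem IsProofStructure.mem_empireForms_iff (h : Θ.IsProofStructure) {a x : Occ}
    (ha : a ∈ Θ.forms) (hx : x ∈ Θ.forms) : x ∈ Θ.empireForms a ↔ x.2 ∈ Θ.net.empire a.2 := by
  classical
  simp only [empireForms, Finset.mem_filter, hx, true_and]
  constructor
  · intro hr S'
    let S : Switching := fun L => match L with
      | .ax _ _ => false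
      | .bin _ _ _ _ _ k => S' k
    exact (h.cutGraph_reachable_iff (S := S) (fun _ _ _ _ _ _ => rfl) ha hx).1 (hr S)
  · intro hr S
    let S' : ℕ → Bool := fun k =>
      decide (∃ A i B j, Link.bin .par A i B j k ∈ Θ.links ∧ S (.bin .par A i B j k) = true)
    refine (h.cutGraph_reachable_iff (S' := S') (fun A i B j k hL => ?_) ha hx).2 (hr S')
    rw [Bool.eq_iff_iff, decide_eq_true_iff]
    refine ⟨fun hs => ⟨A, i, B, j, hL, hs⟩, ?_⟩
    rintro ⟨A', i', B', j', hL', hs⟩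
    rwa [h.link_eq_of_conclusion hL hL' (x := (.bin .par A B, k)) (y := (.bin .par A' B', k))
      (by simp [Link.conclusions]) (by simp [Link.conclusions]) rfl]

/-- The premises `x`, `y` of a link belong to two disjoint empires if and only if they are
conclusions of these empires. -/
theorem IsProofStructure.empire_isConclusion_iff (h : Θ.IsProofStructure) {a b x y : Occ}
    (ha : a ∈ Θ.forms) (hb : b ∈ Θ.forms)
    (hab : Disjoint (Θ.net.empire a.2) (Θ.net.empire b.2)) {L : Link} (hL : L ∈ Θ.links)
    (hx : x ∈ L.premises) (hy : y ∈ L.premises) :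
    (Θ.empire a).IsConclusion x ∧ (Θ.empire b).IsConclusion y ↔
      x.2 ∈ Θ.net.empire a.2 ∧ y.2 ∈ Θ.net.empire b.2 := by
  have hxf := h.premises_subset L hL hx
  have hyf := h.premises_subset L hL hy
  constructor
  · rintro ⟨h1, h2⟩
    exact ⟨(h.mem_empireForms_iff ha hxf).1 h1.1, (h.mem_empireForms_iff hb hyf).1 h2.1⟩
  · rintro ⟨h1, h2⟩
    refine ⟨⟨(h.mem_empireForms_iff ha hxf).2 h1, fun M hM hxM => ?_⟩,
      ⟨(h.mem_empireForms_iff hb hyf).2 h2, fun M hM hyM => ?_⟩⟩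
    -- A link of the empire with premise `x` can only be `L`; it would bring `y` into the empire of
    -- `a`, against disjointness.
    · obtain ⟨hM, hp, -⟩ := Finset.mem_filter.1 hM
      obtain rfl := h.premise_unique x hxf L hL M hM hx hxM
      exact Set.disjoint_left.1 hab ((h.mem_empireForms_iff ha hyf).1 (hp hy)) h2
    · obtain ⟨hM, hp, -⟩ := Finset.mem_filter.1 hM
      obtain rfl := h.premise_unique y hyf L hL M hM hy hyM
      exact Set.disjoint_left.1 hab h1 ((h.mem_empireForms_iff hb hxf).1 (hp hx))

end Structure
end MLL

/-! ### The exchange theorem -/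

theorem theorem1 (Θ : MLL.Structure) (hΘ : Θ.IsProofNet)
    (A B C D : MLL.Formula) (a b t c d q : ℕ)
    (hTens : MLL.Link.bin .tens A a B b t ∈ Θ.links)
    (hPar : MLL.Link.bin .par C c D d q ∈ Θ.links) :
    (Θ.exchange (.bin .tens A a B b t) (.bin .par C c D d q)).IsProofNet ↔
      ((Θ.empire (A, a)).IsConclusion (C, c) ∧ (Θ.empire (B, b)).IsConclusion (D, d)) ∨
      ((Θ.empire (A, a)).IsConclusion (D, d) ∧ (Θ.empire (B, b)).IsConclusion (C, c)) := by
  obtain ⟨h, hseq⟩ := hΘ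
  have hN := h.net_wf
  have hc := hseq.net_correct
  have ht : Θ.net.bin .tens a b t := ⟨_, _, hTens⟩
  have hq : Θ.net.bin .par c d q := ⟨_, _, hPar⟩
  have hex := h.exchange (.bin .tens A a B b t) (.bin .par C c D d q)
  have hm := h.bin_mem_forms hTens
  have hC : (C, c) ∈ (MLL.Link.bin .par C c D d q).premises := by simp [MLL.Link.premises]
  have hD : (D, d) ∈ (MLL.Link.bin .par C c D d q).premises := by simp [MLL.Link.premises]
  have hdisj := hN.empire_disjoint hc ht
  rw [h.empire_isConclusion_iff hm.1 hm.2.1 hdisj hPar hC hD,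
    h.empire_isConclusion_iff hm.1 hm.2.1 hdisj hPar hD hC,
    ← hN.flip_correct_iff hc ht hq, ← h.net_exchange hTens hPar]
  -- The right-hand side has become the correctness of the net of the exchanged structure, so only
  -- the two directions of the Danos-Regnier criterion remain.
  refine ⟨fun h' => h'.2.net_correct, fun h' => ⟨hex, hex.sequentializable ?_ h'⟩⟩
  exact ⟨_, Finset.mem_image_of_mem _ hm.1⟩
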